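/- There are an absolute constant $C>0$ and numbers $0<\nu_c\le\sqrt c$ ($c=1,2,\dots$) such that the following holds. **Setting.** Let $n\ge1$, $B,\epsilon,\delta,\gamma>0$, and let $f_{\mathbf w}(\mathbf x)=W_n\phi(W_{n-1}\cdots\phi(W_1\mathbf x)\cdots)$ be an $n$-layer ReLU network with inputs in $\mathbb R^d$ and $d_y$ output scores, $\phi(t)=\max(t,0)$ coordinatewise, in which every layer (input and output included) has at most $h$ units. Let $\mathcal D$ be a probability distribution on $\{\mathbf x\in\mathbb R^d:\|\mathbf x\|_2\le B\}\times\{1,\dots,d_y\}$ and $\mathcal S=((\mathbf x_q,y_q))_{q\le m}$ a sample of $m$ independent draws from $\mathcal D$; $m_j$ is the number of $q$ with $y_q=j$ and $m_{min}=\min_j m_j$. **Adversarial data.** For a loss $\ell(z,y)$ of a score vector $z$ and a label $y$, an attack on $f_{\mathbf w}$ is a measurable map $(\mathbf x,y)\mapsto\mathbf x'$ with $\mathbf x'\in\arg\max_{\|\mathbf x''-\mathbf x\|_2\le\epsilon}\ell(f_{\mathbf w}(\mathbf x''),y)$ whenever $\|\mathbf x\|_2\le B$. It turns $\mathcal S$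 into $\mathcal S'=((\mathbf x_q',y_q))_q$, and $\mathcal D'$ is the law of $(\mathbf x',y)$ for $(\mathbf x,y)\sim\mathcal D$. A *margin loss* is a loss with $\ell(z,y)>\ell(z',y)$ whenever $z_y-\max_{i\ne y}z_i<z'_y-\max_{i\ne y}z'_i$. **Confusion matrices** ($d_y\times d_y$, zero diagonal). For $i\ne j$, $(\mathcal C_{\mathcal D'})_{ij}$ is the conditional probability, under $(\mathbf x',y)\sim\mathcal D'$ given $y=j$, that $f_{\mathbf w}(\mathbf x')[i]=\max_{i'}f_{\mathbf w}(\mathbf x')[i']$, where a tie between several wrong labels $i\neq j$ is given to the smallest one only (a tie with $j$ counts as an error). So the $j$-th column sum is $\mathbb P(\max_{i\ne j}f_{\mathbf w}(\mathbf x')[i]\ge f_{\mathbf w}(\mathbf x')[j]\mid y=j)$, and $\|\mathcal C_{\mathcal D'}\|_1$ (maximal absolute column sum) is the worst-class robust error. For $i\neq j$, $(\mathcal C_{\mathcal S',\gamma})_{ij}$ is the fraction, among the $m_j$ examples of $\mathcal S'$ with label $j$, of those with $f_{\mathbf w}(\mathbf x')[j]\le\gamma+f_{\mathbf w}(\mathbf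 x')[i]$ and $\arg\max_{i'\ne j}f_{\mathbf w}(\mathbf x')[i']=i$ (ties to the smallest index). $\|\cdot\|_2$ is the spectral norm and $\|\cdot\|_F$ the Frobenius norm. **Bound.** Put $$\Phi'(f_{\mathbf w})=(B+\epsilon)^2n^2h\ln(nh)\prod_{l=1}^n\|W_l\|_2^2\sum_{l=1}^n\frac{\|W_l\|_F^2}{\|W_l\|_2^2}$$ (read as $0$ if some $W_l=0$), and $\nu=\nu_{d_y}$. Consider the event that, if $m_{min}>8d_y$, then both $$\|\mathcal C_{\mathcal D'}\|_1\le\nu\|\mathcal C_{\mathcal S',\gamma}\|_2+C\sqrt{\frac{\nu^2d_y}{m_{min}-8d_y}\Big[\frac{\Phi'(f_{\mathbf w})}{\gamma^2}+\ln\frac{n\,m_{min}}{\delta}\Big]}$$ and $$\|\mathcal C_{\mathcal D'}\|_1\le\nu\|\mathcal C_{\mathcal S',\gamma}\|_2+C\max(1,\gamma)\sqrt{\frac{\nu^2d_y}{(m_{min}-8d_y)\gamma^2}\Big[\Phi'(f_{\mathbf w})+\ln\frac{n\,m_{min}}{\delta}\Big]}.$$ 1. For every loss $\ell$, every fixed $\mathbf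 w$ and every attack on $f_{\mathbf w}$, this event has probability at least $1-\delta$ over the draw of $\mathcal S$. 2. With probability at least $1-\delta$ over the draw of $\mathcal S$, it holds simultaneously for all weights $\mathbf w$ (which may depend on $\mathcal S$), all margin losses and all attacks on $f_{\mathbf w}$. -/

import Mathlib

open MeasureTheory ProbabilityTheory
open scoped Matrix

noncomputable section

namespace RobustConfusion

/-! ### ReLU networks -/

/-- Weights of an `n`-layer network. The layer widths are `k 0` (input dimension), ..., `k n`
(number of outputs, that is, of classes); the `l`-th matrix (counted from `0`) maps layer `l`
to layer `l + 1`. -/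
abbrev Weights (n : ℕ) (k : ℕ → ℕ) : Type :=
  (l : Fin n) → Matrix (Fin (k (l + 1))) (Fin (k l)) ℝ

/-- The ReLU activation function, coordinatewise. -/
def relu {ι : Type*} (v : ι → ℝ) : ι → ℝ := fun i => max (v i) 0

/-- The value at layer `l` before activation: `x`, then `W₁ x`, then `W₂ φ(W₁ x)`, and so on. -/
def layer {n : ℕ} {k : ℕ → ℕ} (W : Weights n k) (x : EuclideanSpace ℝ (Fin (k 0))) :
    (l : ℕ) → l ≤ n → Fin (k l) → ℝ
  | 0, _ => fun i => x i
  | 1, h => W ⟨0, h⟩ *ᵥ fun i => x i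
  | l + 2, h => W ⟨l + 1, h⟩ *ᵥ relu (layer W x (l + 1) (Nat.le_of_succ_le h))

/-- The network `f_w(x) = W_n φ(W_{n-1} ... φ(W_1 x) ...)`, with one score for each class. -/
def net {n : ℕ} {k : ℕ → ℕ} (W : Weights n k) (x : EuclideanSpace ℝ (Fin (k 0))) :
    Fin (k n) → ℝ :=
  layer W x n le_rfl

/-! ### Matrix norms -/

open scoped Matrix.Norms.L2Operator in
/-- Spectral norm (largest singular value): the `ℓ²`-operator norm. -/
def specNorm {p q : ℕ} (M : Matrix (Fin p) (Fin q) ℝ) : ℝ := ‖M‖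

/-- The square of the Frobenius norm. -/
def frobSq {p q : ℕ} (M : Matrix (Fin p) (Fin q) ℝ) : ℝ := ∑ i, ∑ j, M i j ^ 2

/-- The `ℓ¹` matrix norm: the maximal absolute column sum. -/
def colNorm {p q : ℕ} (M : Matrix (Fin p) (Fin q) ℝ) : ℝ := ⨆ j, ∑ i, |M i j|

/-- `Φ'(f_w) = (B+ε)² n² h ln(nh) ∏ ‖W_l‖₂² ∑ ‖W_l‖_F² / ‖W_l‖₂²`. -/
def complexity {n : ℕ} {k : ℕ → ℕ} (h : ℕ) (B ε : ℝ) (W : Weights n k) : ℝ :=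
  (B + ε) ^ 2 * (n : ℝ) ^ 2 * h * Real.log (n * h) *
    (∏ l, specNorm (W l) ^ 2) * ∑ l, frobSq (W l) / specNorm (W l) ^ 2

/-! ### Confusion matrices -/

/-- With scores `z` and true label `j`, the wrong label `i` is output: its score is maximal.
Ties with `j` count as errors; ties between wrong labels go to the smallest one, so that an error
is counted in exactly one place of the `j`-th column. -/
def Predicts {c : ℕ} (z : Fin c → ℝ) (j i : Fin c) : Prop :=
  (∀ i', z i' ≤ z i) ∧ ∀ i', i' ≠ j → i' < i → z i' < z i

/-- `argmax_{i' ≠ j} z[i'] = i`, with ties going to the smallest index. -/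
def IsArgmaxWrong {c : ℕ} (z : Fin c → ℝ) (j i : Fin c) : Prop :=
  (i ≠ j) ∧ (∀ i', i' ≠ j → z i' ≤ z i) ∧ ∀ i', i' ≠ j → i' < i → z i' < z i

/-- The confusion matrix of the score function `f` under the distribution `D`: the `(i, j)` entry
is, for `i ≠ j`, the conditional probability that `i` is output, given that the label is `j`. -/
def trueConfusion {X : Type*} [MeasurableSpace X] {c : ℕ} (f : X → Fin c → ℝ)
    (D : Measure (X × Fin c)) : Matrix (Fin c) (Fin c) ℝ :=
  Matrix.of fun i j =>
    if i = j then 0 else (cond D {p | p.2 = j}).real {p | Predicts (f p.1) j i}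

/-- The number `m_j` of samples with label `j`. -/
def classCount {X : Type*} {m c : ℕ} (S : Fin m → X × Fin c) (j : Fin c) : ℕ :=
  (Finset.univ.filter fun q => (S q).2 = j).card

/-- `m_min`: the least number of samples in one class. -/
def minClassCount {X : Type*} {m c : ℕ} (S : Fin m → X × Fin c) : ℕ := ⨅ j, classCount S j

open Classical in
/-- The empirical confusion matrix with margin `γ` on the sample `S`. -/
def marginConfusion {X : Type*} {m c : ℕ} (γ : ℝ) (f : X → Fin c → ℝ) (S : Fin m → X × Fin c) :
    Matrix (Fin c) (Fin c) ℝ :=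
  Matrix.of fun i j =>
    if i = j then 0 else
      ∑ q, (1 / (classCount S j : ℝ)) *
        (if f (S q).1 (S q).2 ≤ γ + f (S q).1 i ∧ (S q).2 = j ∧
          IsArgmaxWrong (f (S q).1) (S q).2 i then 1 else 0)

/-! ### Adversarial examples -/

/-- `A` maps each example `(x, y)` with `‖x‖ ≤ B` to an adversarial example `x'`: a maximizer of
the loss `ℓ (f x') y` over the closed `ℓ²`-ball of radius `ε` around `x`. -/
structure IsAttack {d c : ℕ} (B ε : ℝ) (ℓ : (Fin c → ℝ) → Fin c → ℝ)
    (f : EuclideanSpace ℝ (Fin d) → Fin c → ℝ)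
    (A : EuclideanSpace ℝ (Fin d) × Fin c → EuclideanSpace ℝ (Fin d)) : Prop where
  measurable : Measurable A
  mem_ball : ∀ x y, ‖x‖ ≤ B → ‖A (x, y) - x‖ ≤ ε
  isMax : ∀ x y, ‖x‖ ≤ B → ∀ x', ‖x' - x‖ ≤ ε → ℓ (f x') y ≤ ℓ (f (A (x, y))) y

/-- The adversarial data distribution `D'`: the law of `(x', y)` for `(x, y)` drawn from `D`. -/
def advMeasure {X : Type*} [MeasurableSpace X] {c : ℕ} (A : X × Fin c → X)
    (D : Measure (X × Fin c)) : Measure (X × Fin c) :=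
  D.map fun p => (A p, p.2)

/-- The adversarial training set `S'`. -/
def advSample {X : Type*} {m c : ℕ} (A : X × Fin c → X) (S : Fin m → X × Fin c) :
    Fin m → X × Fin c :=
  fun q => (A (S q), (S q).2)

/-- The margin `z[y] - max_{i ≠ y} z[i]` of the scores `z` at the label `y`. -/
def margin {c : ℕ} (z : Fin c → ℝ) (y : Fin c) : ℝ := z y - ⨆ i : {i : Fin c // i ≠ y}, z i

/-- A loss that is larger whenever the margin is smaller. -/
def IsMarginLoss {c : ℕ} (ℓ : (Fin c → ℝ) → Fin c → ℝ) : Prop :=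
  ∀ z z' y, margin z y < margin z' y → ℓ z' y < ℓ z y

/-! ### The bound -/

/-- The bound for the sample `S`, the weights `W` and the attack `A`, with the constant `C` in the
place of the `O`-symbol: first with only the complexity term divided by `γ²`, then with both
terms divided by `γ²` (and the same constant if `γ ≤ 1`). -/
def RobustBound {n m : ℕ} {k : ℕ → ℕ} (C ν : ℝ) (h : ℕ) (B ε δ γ : ℝ)
    (D : Measure (EuclideanSpace ℝ (Fin (k 0)) × Fin (k n)))
    (S : Fin m → EuclideanSpace ℝ (Fin (k 0)) × Fin (k n)) (W : Weights n k)
    (A : EuclideanSpace ℝ (Fin (k 0)) × Fin (k n) → EuclideanSpace ℝ (Fin (k 0))) : Prop :=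
  colNorm (trueConfusion (net W) (advMeasure A D)) ≤
      ν * specNorm (marginConfusion γ (net W) (advSample A S)) +
        C * √(ν ^ 2 * k n / ((minClassCount S : ℝ) - 8 * k n) *
          (complexity h B ε W / γ ^ 2 + Real.log (n * minClassCount S / δ))) ∧
    colNorm (trueConfusion (net W) (advMeasure A D)) ≤
      ν * specNorm (marginConfusion γ (net W) (advSample A S)) +
        C * max 1 γ * √(ν ^ 2 * k n / (((minClassCount S : ℝ) - 8 * k n) * γ ^ 2) *
          (complexity h B ε W + Real.log (n * minClassCount S / δ)))

end RobustConfusion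

end

/-! By Cauchy–Schwarz, a column of a matrix with `c` rows has `ℓ¹` norm at most `√c` times the
spectral norm (`sum_abs_le_sqrt_mul_specNorm`). So `ν c = √c` works, and it suffices to compare,
class by class, the conditional probability of a robust error with the frequency of margins at most
`γ` among the adversarial examples of that class.

For one event this is Hoeffding's inequality, except that the class count is random. The exponential
of `expoTerm` has mean at most one, which yields a tail bound for each possible value `s` of the
count (`measure_deviation_le`); a union over `s` with weights `1 / (s (s + 1))` costs only a
logarithm. With a fixed network and a fixed attack there is a single error event per class, so
nothing more is needed, whatever the loss.

For all networks at once, a weighted union bound runs over a countable family of networks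
(`measure_exists_deviation_le`). By positive homogeneity of ReLU, the layers can be normalized to
spectral norm one, with the product `α` of the norms kept as a scalar. If the scores are to be
accurate to `γ / 4` on the ball of radius `R = B + ε`, a layer tolerance `e` of order `γ / (n R α)`
is enough. Greedy removal of rank-one pieces approximates a normalized layer `V` with about `‖V‖_F²
/ e²` of them (`exists_lowRank_of_frobSq_le`), and rounding their entries to a grid leaves finitely
many choices, with about `h` entries per piece. The resulting log-weight is of order `Φ' / γ²`
(`exists_netIndex`).

The attack is removed from the events: for a network of the family, the event is that some point
within `ε` of the clean input has margin at most `γ / 2`. A robust error of the true network forces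
this event. Conversely, on a sample point the event gives a nearby point where the true margin is at
most `γ`, and an attack maximizing a margin loss does at least as well. -/

noncomputable section

namespace RobustConfusion

/-! ### Euclidean norms of vectors and matrices -/

/-- The Euclidean norm of a coordinate vector. -/
def l2 {p : ℕ} (v : Fin p → ℝ) : ℝ := ‖(WithLp.toLp 2 v : EuclideanSpace ℝ (Fin p))‖

lemma l2_nonneg {p : ℕ} (v : Fin p → ℝ) : 0 ≤ l2 v := norm_nonneg _

lemma l2_sq {p : ℕ} (v : Fin p → ℝ) : l2 v ^ 2 = ∑ i, v i ^ 2 := by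
  simp [l2, EuclideanSpace.real_norm_sq_eq]

lemma l2_eq_norm {p : ℕ} (x : EuclideanSpace ℝ (Fin p)) : l2 (fun i => x i) = ‖x‖ := rfl

lemma l2_smul {p : ℕ} (a : ℝ) (v : Fin p → ℝ) : l2 (a • v) = |a| * l2 v := by
  simp [l2, WithLp.toLp_smul, norm_smul]

lemma l2_add_le {p : ℕ} (v w : Fin p → ℝ) : l2 (v + w) ≤ l2 v + l2 w := by
  simpa [l2, WithLp.toLp_add] using norm_add_le (WithLp.toLp 2 v) (WithLp.toLp 2 w)

lemma abs_apply_le_l2 {p : ℕ} (v : Fin p → ℝ) (i : Fin p) : |v i| ≤ l2 v := by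
  refine abs_le_of_sq_le_sq ?_ (l2_nonneg v)
  rw [l2_sq]
  exact Finset.single_le_sum (f := fun i => v i ^ 2) (fun i _ => sq_nonneg _) (Finset.mem_univ i)

lemma l2_le_l2_of_abs_le {p : ℕ} {v w : Fin p → ℝ} (h : ∀ i, |v i| ≤ |w i|) : l2 v ≤ l2 w := by
  refine le_of_sq_le_sq ?_ (l2_nonneg w)
  rw [l2_sq, l2_sq]
  exact Finset.sum_le_sum fun i _ => sq_le_sq.2 (h i)

lemma l2_relu_le {p : ℕ} (v : Fin p → ℝ) : l2 (relu v) ≤ l2 v :=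
  l2_le_l2_of_abs_le fun i => by
    simp only [relu]
    rcases le_total (v i) 0 with h | h <;> simp [h]

lemma l2_relu_sub_le {p : ℕ} (v w : Fin p → ℝ) : l2 (relu v - relu w) ≤ l2 (v - w) :=
  l2_le_l2_of_abs_le fun i => by
    simpa [relu] using abs_max_sub_max_le_abs (v i) (w i) 0

lemma relu_smul {ι : Type*} {a : ℝ} (ha : 0 ≤ a) (v : ι → ℝ) : relu (a • v) = a • relu v := by
  ext i
  simp [relu, mul_max_of_nonneg _ _ ha]

open scoped Matrix.Norms.L2Operator in
lemma specNorm_nonneg {p q : ℕ} (M : Matrix (Fin p) (Fin q) ℝ) : 0 ≤ specNorm M := by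
  unfold specNorm; exact norm_nonneg _

lemma l2_mulVec_le {p q : ℕ} (M : Matrix (Fin p) (Fin q) ℝ) (v : Fin q → ℝ) :
    l2 (M *ᵥ v) ≤ specNorm M * l2 v := by
  unfold specNorm
  exact Matrix.l2_opNorm_mulVec M (WithLp.toLp 2 v)

lemma specNorm_le {p q : ℕ} {M : Matrix (Fin p) (Fin q) ℝ} {a : ℝ} (ha : 0 ≤ a)
    (h : ∀ v, l2 (M *ᵥ v) ≤ a * l2 v) : specNorm M ≤ a := by
  unfold specNorm
  rw [Matrix.l2_opNorm_def]
  exact ContinuousLinearMap.opNorm_le_bound _ ha fun x => h x.ofLp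

open scoped Matrix.Norms.L2Operator in
lemma specNorm_add_le {p q : ℕ} (M N : Matrix (Fin p) (Fin q) ℝ) :
    specNorm (M + N) ≤ specNorm M + specNorm N := by
  unfold specNorm; exact norm_add_le _ _

open scoped Matrix.Norms.L2Operator in
lemma specNorm_smul {p q : ℕ} (a : ℝ) (M : Matrix (Fin p) (Fin q) ℝ) :
    specNorm (a • M) = |a| * specNorm M := by
  unfold specNorm; exact norm_smul _ _

open scoped Matrix.Norms.L2Operator in
lemma specNorm_eq_zero {p q : ℕ} {M : Matrix (Fin p) (Fin q) ℝ} :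
    specNorm M = 0 ↔ M = 0 := by
  unfold specNorm; exact norm_eq_zero

lemma abs_apply_le_specNorm {p q : ℕ} (M : Matrix (Fin p) (Fin q) ℝ) (i : Fin p) (j : Fin q) :
    |M i j| ≤ specNorm M := by
  have h1 := l2_mulVec_le M (Pi.single j 1)
  have h2 := abs_apply_le_l2 (M *ᵥ Pi.single j 1) i
  have h3 : l2 (Pi.single j 1 : Fin q → ℝ) = 1 := by simp [l2]
  rw [h3] at h1
  simp at h1 h2
  exact h2.trans h1

lemma frobSq_nonneg {p q : ℕ} (M : Matrix (Fin p) (Fin q) ℝ) : 0 ≤ frobSq M :=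
  Finset.sum_nonneg fun _ _ => Finset.sum_nonneg fun _ _ => sq_nonneg _

lemma frobSq_smul {p q : ℕ} (a : ℝ) (M : Matrix (Fin p) (Fin q) ℝ) :
    frobSq (a • M) = a ^ 2 * frobSq M := by
  simp [frobSq, mul_pow, Finset.mul_sum]

lemma l2_mulVec_sq_le_frobSq {p q : ℕ} (M : Matrix (Fin p) (Fin q) ℝ) (v : Fin q → ℝ) :
    l2 (M *ᵥ v) ^ 2 ≤ frobSq M * l2 v ^ 2 := by
  rw [l2_sq, l2_sq, frobSq, Finset.sum_mul]
  exact Finset.sum_le_sum fun i _ =>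
    Finset.sum_mul_sq_le_sq_mul_sq Finset.univ (fun j => M i j) v

lemma specNorm_sq_le_frobSq {p q : ℕ} (M : Matrix (Fin p) (Fin q) ℝ) :
    specNorm M ^ 2 ≤ frobSq M := by
  have : specNorm M ≤ √(frobSq M) := specNorm_le (Real.sqrt_nonneg _) fun v => by
    refine le_of_sq_le_sq ?_ (mul_nonneg (Real.sqrt_nonneg _) (l2_nonneg v))
    rw [mul_pow, Real.sq_sqrt (frobSq_nonneg M)]
    exact l2_mulVec_sq_le_frobSq M v
  calc specNorm M ^ 2 ≤ √(frobSq M) ^ 2 := by gcongr; exact specNorm_nonneg M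
    _ = frobSq M := Real.sq_sqrt (frobSq_nonneg M)

/-- Subtracting the rank-one matrix `(M v) vᵀ`, for a unit vector `v`, lowers the squared
Frobenius norm by `‖M v‖²`. -/
lemma frobSq_sub_vecMulVec {p q : ℕ} (M : Matrix (Fin p) (Fin q) ℝ) {v : Fin q → ℝ}
    (hv : l2 v = 1) :
    frobSq (M - Matrix.vecMulVec (M *ᵥ v) v) = frobSq M - l2 (M *ᵥ v) ^ 2 := by
  have hv2 : ∑ j, v j ^ 2 = 1 := by rw [← l2_sq, hv, one_pow]
  rw [l2_sq, frobSq, frobSq, ← Finset.sum_sub_distrib]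
  refine Finset.sum_congr rfl fun i _ => ?_
  have h : (M *ᵥ v) i = ∑ j, M i j * v j := rfl
  calc ∑ j, (M - Matrix.vecMulVec (M *ᵥ v) v) i j ^ 2
      = ∑ j, (M i j ^ 2 - 2 * (M *ᵥ v) i * (M i j * v j) + (M *ᵥ v) i ^ 2 * v j ^ 2) := by
        refine Finset.sum_congr rfl fun j _ => ?_
        simp only [Matrix.sub_apply, Matrix.vecMulVec_apply]
        ring
    _ = _ := by
        rw [Finset.sum_add_distrib, Finset.sum_sub_distrib, ← Finset.mul_sum, ← Finset.mul_sum,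
          hv2, ← h]
        ring

/-- A matrix with Frobenius norm at most `√t · e` is within `e`, in spectral norm, of a sum of `t`
rank-one matrices. -/
lemma exists_lowRank_of_frobSq_le {p q : ℕ} {e : ℝ} (he : 0 ≤ e) {F : ℝ} (hF : 0 ≤ F) (hF1 : 1 ≤ F)
    (t : ℕ) (M : Matrix (Fin p) (Fin q) ℝ) (hM : frobSq M ≤ t * e ^ 2) (hMF : frobSq M ≤ F ^ 2) :
    ∃ (u : Fin t → Fin p → ℝ) (v : Fin t → Fin q → ℝ),
      (∀ i a, |u i a| ≤ F) ∧ (∀ i a, |v i a| ≤ F) ∧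
      specNorm (M - ∑ i, Matrix.vecMulVec (u i) (v i)) ≤ e := by
  induction t generalizing M with
  | zero =>
    refine ⟨fun i => i.elim0, fun i => i.elim0, fun i => i.elim0, fun i => i.elim0, ?_⟩
    have h1 := specNorm_sq_le_frobSq M
    have h2 : specNorm M ^ 2 ≤ 0 := by
      simpa using h1.trans hM
    have h3 : specNorm M = 0 := by nlinarith [specNorm_nonneg M, sq_nonneg (specNorm M)]
    simp [h3, he]
  | succ t ih =>
    by_cases hs : specNorm M ≤ e
    · exact ⟨fun _ => 0, fun _ => 0, by simp [hF], by simp [hF], by simpa using hs⟩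
    -- Greedy step: a unit vector stretched by at least `e` yields a rank-one piece whose removal
    -- lowers the squared Frobenius norm by at least `e ^ 2`, so the budget `t * e ^ 2` pays for at
    -- most `t` removals. The bound `F` keeps the entries of the pieces within the range of the
    -- grid.
    · have : ∃ v, e * l2 v < l2 (M *ᵥ v) := by
        by_contra! hc
        exact hs (specNorm_le he hc)
      obtain ⟨w, hw⟩ := this
      have hw0 : 0 < l2 w := by
        rcases (l2_nonneg w).eq_or_lt with h | h
        · have := l2_mulVec_le M w
          rw [← h] at this hw
          simp at this hw
          linarith
        · exact h
      set v : Fin q → ℝ := (l2 w)⁻¹ • w with hvdef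
      have hv : l2 v = 1 := by
        rw [hvdef, l2_smul, abs_of_pos (inv_pos.2 hw0), inv_mul_cancel₀ hw0.ne']
      have hMv : e ≤ l2 (M *ᵥ v) := by
        rw [hvdef, Matrix.mulVec_smul, l2_smul, abs_of_pos (inv_pos.2 hw0), inv_mul_eq_div,
          le_div_iff₀ hw0]
        exact hw.le
      have hMv2 : e ^ 2 ≤ l2 (M *ᵥ v) ^ 2 := by gcongr
      have hfr := frobSq_sub_vecMulVec M hv
      have hMvF : l2 (M *ᵥ v) ≤ F := by
        refine le_of_sq_le_sq ?_ hF
        have := l2_mulVec_sq_le_frobSq M v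
        rw [hv] at this
        linarith
      obtain ⟨u', v', hu', hv', h'⟩ := ih (M - Matrix.vecMulVec (M *ᵥ v) v)
        (by rw [hfr]; push_cast at hM; linarith) (by rw [hfr]; nlinarith [sq_nonneg (l2 (M *ᵥ v))])
      refine ⟨Fin.cons (M *ᵥ v) u', Fin.cons v v', ?_, ?_, ?_⟩
      · refine Fin.cases ?_ ?_
        · intro a; exact (abs_apply_le_l2 _ a).trans hMvF
        · intro i a; exact hu' i a
      · refine Fin.cases ?_ ?_
        · intro a; exact ((abs_apply_le_l2 _ a).trans hv.le).trans hF1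
        · intro i a; exact hv' i a
      · rw [Fin.sum_univ_succ]
        simpa [sub_sub] using h'

/-- A matrix is the sum of its columns times unit row vectors. -/
lemma eq_sum_vecMulVec_single {p q : ℕ} (M : Matrix (Fin p) (Fin q) ℝ) :
    M = ∑ i, Matrix.vecMulVec (fun a => M a i) (Pi.single i 1) := by
  ext a b
  simp [Matrix.sum_apply, Matrix.vecMulVec_apply, Pi.single_apply]

/-- A contraction is close to a sum of `t` rank-one matrices if `t` is the number of columns or
large in terms of the Frobenius norm. -/
lemma exists_lowRank {p q h : ℕ} (hq : q ≤ h) (hh : 1 ≤ h) {e : ℝ} (he : 0 ≤ e) (he1 : e ≤ 1)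
    {t : ℕ} (ht : t ≤ q)
    (M : Matrix (Fin p) (Fin q) ℝ) (hM : specNorm M ≤ 1) (hMt : frobSq M ≤ t * e ^ 2 ∨ t = q) :
    ∃ (u : Fin t → Fin p → ℝ) (v : Fin t → Fin q → ℝ),
      (∀ i a, |u i a| ≤ h) ∧ (∀ i a, |v i a| ≤ h) ∧
      specNorm (M - ∑ i, Matrix.vecMulVec (u i) (v i)) ≤ e := by
  have hh' : (1 : ℝ) ≤ h := by exact_mod_cast hh
  rcases hMt with hMt | rfl
  · refine exists_lowRank_of_frobSq_le he (by positivity) hh' t M hMt (hMt.trans ?_)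
    have : (t : ℝ) ≤ h := by exact_mod_cast ht.trans hq
    calc t * e ^ 2 ≤ h * 1 ^ 2 := by gcongr
      _ ≤ (h : ℝ) ^ 2 := by nlinarith
  · refine ⟨fun i a => M a i, fun i => Pi.single i 1, fun i a =>
      ((abs_apply_le_specNorm M a i).trans hM).trans hh', fun i a => ?_, ?_⟩
    · by_cases hia : a = i
      · subst hia; simpa using hh'
      · simp [hia]
    · rw [← eq_sum_vecMulVec_single, sub_self, specNorm_eq_zero.2 rfl]
      exact he

/-- Real numbers in `[-h, h]`, rounded to a grid of `2 h N + 1` points. -/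
lemma exists_grid_approx {h N : ℕ} (hN : 0 < N) {x : ℝ} (hx : |x| ≤ h) :
    ∃ i : Fin (2 * h * N + 1), |x - ((i : ℝ) / N - h)| ≤ 1 / N ∧ |(i : ℝ) / N - h| ≤ h := by
  have hN' : (0 : ℝ) < N := by exact_mod_cast hN
  obtain ⟨h1, h2⟩ := abs_le.1 hx
  have h0 : 0 ≤ (x + h) * N := mul_nonneg (by linarith) hN'.le
  have hfl := Nat.floor_le h0
  have hfl2 := Nat.lt_floor_add_one ((x + h) * N)
  have hle : (⌊(x + h) * N⌋₊ : ℝ) ≤ 2 * h * N := hfl.trans (by gcongr; linarith)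
  have hle' : ⌊(x + h) * N⌋₊ ≤ 2 * h * N := by exact_mod_cast hle
  refine ⟨⟨⌊(x + h) * N⌋₊, by omega⟩, ?_, ?_⟩
  · simp only
    have e1 : x - ((⌊(x + h) * N⌋₊ : ℝ) / N - h) = ((x + h) * N - ⌊(x + h) * N⌋₊) / N := by
      field_simp; ring
    rw [e1, abs_of_nonneg (div_nonneg (by linarith) hN'.le)]
    gcongr
    linarith
  · simp only
    rw [abs_le]
    constructor
    · have : 0 ≤ (⌊(x + h) * N⌋₊ : ℝ) / N := by positivity
      linarith
    · have : (⌊(x + h) * N⌋₊ : ℝ) / N ≤ 2 * h := by rw [div_le_iff₀ hN']; exact hle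
      linarith

/-- The sums of `t` rank-one matrices with entries on the grid. -/
def gridNet (p q h N t : ℕ) : Finset (Matrix (Fin p) (Fin q) ℝ) := by
  classical exact
  (Finset.univ : Finset ((Fin t → Fin p → Fin (2 * h * N + 1)) ×
    (Fin t → Fin q → Fin (2 * h * N + 1)))).image fun c =>
      ∑ i, Matrix.vecMulVec (fun a => (c.1 i a : ℝ) / N - h) (fun b => (c.2 i b : ℝ) / N - h)

lemma card_gridNet_le {p q h N t : ℕ} (hp : p ≤ h) (hq : q ≤ h) :
    (gridNet p q h N t).card ≤ (2 * h * N + 1) ^ (2 * h * t) := by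
  classical
  refine Finset.card_image_le.trans ?_
  rw [Finset.card_univ, Fintype.card_prod]
  simp only [Fintype.card_fun, Fintype.card_fin]
  rw [← pow_mul, ← pow_mul, ← pow_add]
  refine Nat.pow_le_pow_right (by omega) ?_
  rw [← add_mul]
  exact Nat.mul_le_mul_right t (by omega)

/-- Rounding both factors of a product of numbers in `[-h, h]` costs `2 h / N`. Each entry is a sum
of at most `h` such products, and passing from entries to the Frobenius norm of a matrix of size at
most `h × h` costs one more factor `h`. -/
lemma exists_mem_gridNet {p q h N t : ℕ} (hp : p ≤ h) (hq : q ≤ h) (ht : t ≤ h) (hN : 0 < N)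
    {u : Fin t → Fin p → ℝ} {v : Fin t → Fin q → ℝ}
    (hu : ∀ i a, |u i a| ≤ h) (hv : ∀ i a, |v i a| ≤ h) :
    ∃ M ∈ gridNet p q h N t,
      specNorm (∑ i, Matrix.vecMulVec (u i) (v i) - M) ≤ 2 * (h : ℝ) ^ 3 / N := by
  classical
  have hN' : (0 : ℝ) < N := by exact_mod_cast hN
  choose cu hcu hcu' using fun i a => exists_grid_approx hN (hu i a)
  choose cv hcv hcv' using fun i a => exists_grid_approx hN (hv i a)
  refine ⟨_, Finset.mem_image.2 ⟨(cu, cv), Finset.mem_univ _, rfl⟩, ?_⟩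
  set E := ∑ i, Matrix.vecMulVec (u i) (v i) - ∑ i, Matrix.vecMulVec
    (fun a => (cu i a : ℝ) / N - h) (fun b => (cv i b : ℝ) / N - h) with hE
  have hent : ∀ a b, |E a b| ≤ 2 * (h : ℝ) ^ 2 / N := by
    intro a b
    have e1 : E a b = ∑ i, (u i a * v i b - ((cu i a : ℝ) / N - h) * ((cv i b : ℝ) / N - h)) := by
      simp [hE, Matrix.sum_apply, Matrix.vecMulVec_apply, Finset.sum_sub_distrib]
    rw [e1]
    refine (Finset.abs_sum_le_sum_abs _ _).trans ?_
    calc ∑ i : Fin t, |u i a * v i b - ((cu i a : ℝ) / N - h) * ((cv i b : ℝ) / N - h)|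
        ≤ ∑ i : Fin t, 2 * (h : ℝ) / N := by
          refine Finset.sum_le_sum fun i _ => ?_
          have e2 : u i a * v i b - ((cu i a : ℝ) / N - h) * ((cv i b : ℝ) / N - h)
              = (u i a - ((cu i a : ℝ) / N - h)) * v i b
                + ((cu i a : ℝ) / N - h) * (v i b - ((cv i b : ℝ) / N - h)) := by ring
          rw [e2]
          refine (abs_add_le _ _).trans ?_
          rw [abs_mul, abs_mul]
          calc _ ≤ 1 / (N : ℝ) * h + h * (1 / N) := by
                gcongr
                · exact hcu i a
                · exact hv i b
                · exact hcu' i a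
                · exact hcv i b
            _ = _ := by ring
      _ = t * (2 * (h : ℝ) / N) := by simp
      _ ≤ h * (2 * (h : ℝ) / N) := by gcongr
      _ = _ := by ring
  have hsq : specNorm E ^ 2 ≤ (2 * (h : ℝ) ^ 3 / N) ^ 2 := by
    refine (specNorm_sq_le_frobSq E).trans ?_
    calc frobSq E ≤ ∑ _a : Fin p, ∑ _b : Fin q, (2 * (h : ℝ) ^ 2 / N) ^ 2 := by
          refine Finset.sum_le_sum fun a _ => Finset.sum_le_sum fun b _ => ?_
          rw [← sq_abs]
          gcongr
          exact hent a b
      _ = p * (q * (2 * (h : ℝ) ^ 2 / N) ^ 2) := by simp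
      _ ≤ h * (h * (2 * (h : ℝ) ^ 2 / N) ^ 2) := by gcongr
      _ = _ := by ring
  exact le_of_sq_le_sq hsq (by positivity)

/-! ### Perturbation of ReLU networks -/

lemma layer_smul {n : ℕ} {k : ℕ → ℕ} {c : ℕ → ℝ} (hc : ∀ i, 0 ≤ c i) (V : Weights n k)
    (x : EuclideanSpace ℝ (Fin (k 0))) :
    ∀ (l : ℕ) (hl : l ≤ n), layer (fun i : Fin n => c i • V i) x l hl =
      (∏ i ∈ Finset.range l, c i) • layer V x l hl
  | 0, _ => by simp [layer]
  | 1, _ => by simp [layer, Matrix.smul_mulVec]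
  | l + 2, hl => by
    rw [layer, layer, layer_smul hc V x (l + 1), relu_smul (Finset.prod_nonneg fun i _ => hc i),
      Matrix.mulVec_smul, Matrix.smul_mulVec, smul_smul, Finset.prod_range_succ _ (l + 1)]

lemma l2_layer_le {n : ℕ} {k : ℕ → ℕ} {V : Weights n k} (hV : ∀ l, specNorm (V l) ≤ 1)
    (x : EuclideanSpace ℝ (Fin (k 0))) :
    ∀ (l : ℕ) (hl : l ≤ n), l2 (layer V x l hl) ≤ ‖x‖
  | 0, _ => (l2_eq_norm x).le
  | 1, hl => (l2_mulVec_le _ _).trans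
      ((mul_le_mul_of_nonneg_right (hV _) (l2_nonneg _)).trans (by rw [one_mul, l2_eq_norm]))
  | l + 2, hl => by
    rw [layer]
    refine (l2_mulVec_le _ _).trans
      ((mul_le_mul_of_nonneg_right (hV _) (l2_nonneg _)).trans ?_)
    rw [one_mul]
    exact (l2_relu_le _).trans (l2_layer_le hV x (l + 1) _)

lemma l2_mulVec_sub_mulVec_le {p q : ℕ} {U V : Matrix (Fin p) (Fin q) ℝ} {η : ℝ}
    (hV : specNorm V ≤ 1) (hU : specNorm (U - V) ≤ η) (u v : Fin q → ℝ) :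
    l2 (U *ᵥ u - V *ᵥ v) ≤ (1 + η) * l2 (u - v) + η * l2 v := by
  have hU1 : specNorm U ≤ 1 + η := by
    have := specNorm_add_le V (U - V)
    rw [add_sub_cancel] at this
    linarith
  have e : U *ᵥ u - V *ᵥ v = U *ᵥ (u - v) + (U - V) *ᵥ v := by
    rw [Matrix.mulVec_sub, Matrix.sub_mulVec]; abel
  rw [e]
  refine (l2_add_le _ _).trans (add_le_add ?_ ?_)
  · exact (l2_mulVec_le _ _).trans (mul_le_mul_of_nonneg_right hU1 (l2_nonneg _))
  · exact (l2_mulVec_le _ _).trans (mul_le_mul_of_nonneg_right hU (l2_nonneg _))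

/-- The errors obey `d (l + 1) ≤ (1 + η) * d l + η * ‖x‖`, because ReLU is 1-Lipschitz and the
layers of `V` do not increase norms; the stated bound solves this recursion. -/
lemma l2_layer_sub_le {n : ℕ} {k : ℕ → ℕ} {U V : Weights n k} {η : ℝ} (hη : 0 ≤ η)
    (hV : ∀ l, specNorm (V l) ≤ 1) (hU : ∀ l, specNorm (U l - V l) ≤ η)
    (x : EuclideanSpace ℝ (Fin (k 0))) :
    ∀ (l : ℕ) (hl : l ≤ n), l2 (layer U x l hl - layer V x l hl) ≤ ((1 + η) ^ l - 1) * ‖x‖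
  | 0, _ => by simp [layer, l2]
  | 1, hl => by
    rw [layer, layer]
    refine (l2_mulVec_sub_mulVec_le (hV _) (hU _) _ _).trans ?_
    rw [sub_self, l2_eq_norm]
    simp [l2]
  | l + 2, hl => by
    rw [layer, layer]
    refine (l2_mulVec_sub_mulVec_le (hV _) (hU _) _ _).trans ?_
    have h1 := (l2_relu_sub_le _ _).trans
      (l2_layer_sub_le hη hV hU x (l + 1) (Nat.le_of_succ_le hl))
    have h2 := (l2_relu_le _).trans (l2_layer_le hV x (l + 1) (Nat.le_of_succ_le hl))
    calc _ ≤ (1 + η) * (((1 + η) ^ (l + 1) - 1) * ‖x‖) + η * ‖x‖ := by gcongr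
      _ = _ := by ring

lemma continuous_layer {n : ℕ} {k : ℕ → ℕ} (W : Weights n k) :
    ∀ (l : ℕ) (hl : l ≤ n), Continuous fun x => layer W x l hl
  | 0, _ => by
    simp only [layer]
    fun_prop
  | 1, hl => by
    simp only [layer]
    exact Continuous.matrix_mulVec continuous_const (by fun_prop)
  | l + 2, hl => by
    simp only [layer]
    refine Continuous.matrix_mulVec continuous_const (continuous_pi fun i => ?_)
    exact ((continuous_apply i).comp (continuous_layer W (l + 1) _)).max continuous_const

lemma continuous_net {n : ℕ} {k : ℕ → ℕ} (W : Weights n k) : Continuous (net W) :=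
  continuous_layer W n le_rfl

/-- A network is the product of the spectral norms times the network with normalized layers. -/
lemma net_eq_prod_smul {n : ℕ} {k : ℕ → ℕ} (W : Weights n k) (hW : ∀ l, specNorm (W l) ≠ 0)
    (x : EuclideanSpace ℝ (Fin (k 0))) :
    net W x = (∏ l, specNorm (W l)) • net (fun l => (specNorm (W l))⁻¹ • W l) x := by
  let c : ℕ → ℝ := fun i => if hi : i < n then specNorm (W ⟨i, hi⟩) else 0
  have hc : ∀ i, 0 ≤ c i := fun i => by
    by_cases hi : i < n <;> simp [c, hi, specNorm_nonneg]
  have hcl : ∀ l : Fin n, c l = specNorm (W l) := fun l => by simp [c]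
  have h := layer_smul hc (fun l => (specNorm (W l))⁻¹ • W l) x n le_rfl
  rw [Finset.prod_range] at h
  simp only [hcl, smul_smul, mul_inv_cancel₀ (hW _), one_smul] at h
  exact h

lemma l2_net_le {n : ℕ} {k : ℕ → ℕ} (W : Weights n k) (hW : ∀ l, specNorm (W l) ≠ 0)
    (x : EuclideanSpace ℝ (Fin (k 0))) :
    l2 (net W x) ≤ (∏ l, specNorm (W l)) * ‖x‖ := by
  have hp : 0 ≤ ∏ l, specNorm (W l) := Finset.prod_nonneg fun l _ => specNorm_nonneg _
  rw [net_eq_prod_smul W hW, l2_smul, abs_of_nonneg hp]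
  refine mul_le_mul_of_nonneg_left (l2_layer_le (fun l => ?_) x n le_rfl) hp
  rw [specNorm_smul, abs_of_nonneg (inv_nonneg.2 (specNorm_nonneg _)), inv_mul_cancel₀ (hW l)]

lemma layer_eq_zero {n : ℕ} {k : ℕ → ℕ} {W : Weights n k} {l₀ : Fin n} (hl₀ : W l₀ = 0)
    (x : EuclideanSpace ℝ (Fin (k 0))) :
    ∀ (l : ℕ) (hl : l ≤ n), (l₀ : ℕ) < l → layer W x l hl = 0
  | 0, _, h => by omega
  | 1, hl, h => by
    have : l₀ = ⟨0, hl⟩ := Fin.ext (by simpa using h)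
    subst this
    rw [layer, hl₀, Matrix.zero_mulVec]
  | l + 2, hl, h => by
    rw [layer]
    by_cases h' : (l₀ : ℕ) = l + 1
    · have : l₀ = ⟨l + 1, hl⟩ := Fin.ext h'
      subst this
      rw [hl₀, Matrix.zero_mulVec]
    · rw [layer_eq_zero hl₀ x (l + 1) _ (by omega)]
      have : relu (0 : Fin (k (l + 1)) → ℝ) = 0 := by ext; simp [relu]
      rw [this, Matrix.mulVec_zero]

lemma net_eq_zero {n : ℕ} {k : ℕ → ℕ} {W : Weights n k} {l₀ : Fin n} (hl₀ : W l₀ = 0)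
    (x : EuclideanSpace ℝ (Fin (k 0))) : net W x = 0 :=
  layer_eq_zero hl₀ x n le_rfl l₀.2

/-! ### A finite net for networks -/

/-- Networks whose `l`-th layer is a sum of `t l` rank-one matrices with entries on a grid; the
grid is the finer, the larger `a` is. -/
def weightNet (n : ℕ) (k : ℕ → ℕ) (h a : ℕ) (t : Fin n → ℕ) : Finset (Weights n k) :=
  Fintype.piFinset fun l => gridNet (k (l + 1)) (k l) h (8 * n * a * h ^ 3) (t l)

lemma card_weightNet_le {n : ℕ} {k : ℕ → ℕ} {h : ℕ} (hk : ∀ l ≤ n, k l ≤ h) (a : ℕ)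
    (t : Fin n → ℕ) :
    (weightNet n k h a t).card ≤ (16 * n * a * h ^ 4 + 1) ^ (2 * h * ∑ l, t l) := by
  rw [weightNet, Fintype.card_piFinset, Finset.mul_sum, ← Finset.prod_pow_eq_pow_sum]
  refine Finset.prod_le_prod' fun l _ => ?_
  refine (card_gridNet_le (hk _ l.2) (hk _ l.2.le)).trans (le_of_eq ?_)
  congr 2
  ring

/-- Layer tolerance `1 / (2 n a)` thus accumulates over `n` layers to relative error at most `1 /
a`. -/
lemma one_add_pow_sub_one_le {n a : ℕ} (hn : 0 < n) (ha : 0 < a) :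
    (1 + 1 / (2 * n * a : ℝ)) ^ n - 1 ≤ 1 / a := by
  have hn' : (0 : ℝ) < n := by exact_mod_cast hn
  have ha' : (1 : ℝ) ≤ a := by exact_mod_cast ha
  set y : ℝ := 1 / (2 * a) with hy
  have hy0 : 0 < y := by positivity
  have hy1 : y ≤ 1 / 2 := by
    rw [hy, div_le_div_iff₀ (by positivity) (by norm_num)]; linarith
  have e1 : (1 + 1 / (2 * n * a : ℝ)) ^ n ≤ Real.exp y := by
    calc (1 + 1 / (2 * n * a : ℝ)) ^ n ≤ Real.exp (1 / (2 * n * a : ℝ)) ^ n := by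
          gcongr
          rw [add_comm]
          exact Real.add_one_le_exp _
      _ = Real.exp y := by
          rw [← Real.exp_nat_mul]
          congr 1
          rw [hy]
          field_simp
  have e2 : Real.exp y ≤ 1 / (1 - y) :=
    Real.exp_bound_div_one_sub_of_interval hy0.le (by linarith)
  have e3 : 1 / (1 - y) ≤ 1 + 2 * y := by
    rw [div_le_iff₀ (by linarith)]; nlinarith
  have e4 : 2 * y = 1 / a := by rw [hy]; field_simp
  linarith

lemma exists_mem_weightNet {n : ℕ} {k : ℕ → ℕ} {h a : ℕ} (hk : ∀ l ≤ n, k l ≤ h) (hn : 0 < n)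
    (hh : 0 < h) (ha : 0 < a) (V : Weights n k) (hV : ∀ l, specNorm (V l) ≤ 1) :
    ∃ t : Fin n → ℕ, (∀ l, t l ≤ h) ∧
      (∀ l, (t l : ℝ) ≤ 16 * (n : ℝ) ^ 2 * (a : ℝ) ^ 2 * frobSq (V l) + 1) ∧
      ∃ U ∈ weightNet n k h a t, ∀ l, specNorm (U l - V l) ≤ 1 / (2 * n * a : ℝ) := by
  have hn' : (1 : ℝ) ≤ n := by exact_mod_cast hn
  have ha' : (1 : ℝ) ≤ a := by exact_mod_cast ha
  have hh' : (1 : ℝ) ≤ h := by exact_mod_cast hh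
  -- Half of the tolerance `1 / (2 n a)` goes to the rank truncation and half to the rounding; the
  -- factor `16 n² a²` in the rank below is `1 / e ^ 2`. Capping the rank at the number of columns
  -- loses nothing, since that many rank-one pieces give the matrix exactly.
  set e : ℝ := 1 / (4 * n * a) with he
  have he0 : 0 < e := by positivity
  have he1 : e ≤ 1 := by
    rw [he, div_le_one (by positivity)]; nlinarith
  let t : Fin n → ℕ := fun l => min (k l) ⌈16 * (n : ℝ) ^ 2 * (a : ℝ) ^ 2 * frobSq (V l)⌉₊
  have htk : ∀ l, t l ≤ k l := fun l => min_le_left _ _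
  have hth : ∀ l, t l ≤ h := fun l => (htk l).trans (hk _ l.2.le)
  refine ⟨t, hth, fun l => ?_, ?_⟩
  · have h1 : (t l : ℝ) ≤ ⌈16 * (n : ℝ) ^ 2 * (a : ℝ) ^ 2 * frobSq (V l)⌉₊ :=
      Nat.cast_le.2 (min_le_right _ _)
    have h2 := Nat.ceil_lt_add_one (a := 16 * (n : ℝ) ^ 2 * (a : ℝ) ^ 2 * frobSq (V l))
      (by have := frobSq_nonneg (V l); positivity)
    linarith
  · have key : ∀ l : Fin n, ∃ M ∈ gridNet (k (l + 1)) (k l) h (8 * n * a * h ^ 3) (t l),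
        specNorm (M - V l) ≤ 1 / (2 * n * a : ℝ) := by
      intro l
      have hor : frobSq (V l) ≤ t l * e ^ 2 ∨ t l = k l := by
        rcases min_choice (k l) ⌈16 * (n : ℝ) ^ 2 * (a : ℝ) ^ 2 * frobSq (V l)⌉₊ with h1 | h1
        · exact Or.inr h1
        · left
          have h2 : 16 * (n : ℝ) ^ 2 * (a : ℝ) ^ 2 * frobSq (V l) ≤ t l := by
            simp only [t, h1]; exact Nat.le_ceil _
          calc frobSq (V l) = 16 * (n : ℝ) ^ 2 * (a : ℝ) ^ 2 * frobSq (V l) * e ^ 2 := by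
                rw [he]; field_simp; norm_num
            _ ≤ _ := by gcongr
      obtain ⟨u, v, hu, hv, huv⟩ :=
        exists_lowRank (hk _ l.2.le) hh he0.le he1 (htk l) (V l) (hV l) hor
      obtain ⟨M, hM, hMs⟩ := exists_mem_gridNet (N := 8 * n * a * h ^ 3) (hk _ l.2) (hk _ l.2.le)
        (hth l) (by positivity) hu hv
      refine ⟨M, hM, ?_⟩
      have e1 : 2 * (h : ℝ) ^ 3 / ((8 * n * a * h ^ 3 : ℕ) : ℝ) = e := by
        rw [he]; push_cast; field_simp; norm_num
      rw [e1] at hMs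
      have e2 : V l - M = (V l - ∑ i, Matrix.vecMulVec (u i) (v i))
          + (∑ i, Matrix.vecMulVec (u i) (v i) - M) := by abel
      have e3 : specNorm (M - V l) = specNorm (V l - M) := by
        rw [← neg_sub, ← neg_one_smul ℝ, specNorm_smul]; simp
      have e4 : 1 / (2 * n * a : ℝ) = e + e := by rw [he]; field_simp; norm_num
      rw [e3, e2, e4]
      exact (specNorm_add_le _ _).trans (add_le_add huv hMs)
    choose U hU hU' using key
    exact ⟨U, Fintype.mem_piFinset.2 hU, hU'⟩

/-- Every network is uniformly close, on a ball, to a multiple of a network in the net. -/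
lemma exists_net_approx {n : ℕ} {k : ℕ → ℕ} {h a : ℕ} (hk : ∀ l ≤ n, k l ≤ h) (hn : 0 < n)
    (hh : 0 < h) (W : Weights n k) (hW : ∀ l, specNorm (W l) ≠ 0) {R γ : ℝ} (hR : 0 < R)
    (hγ : 0 < γ) (ha : a = ⌈8 * (R * (∏ l, specNorm (W l)) / γ)⌉₊) :
    ∃ t : Fin n → ℕ, (∀ l, t l ≤ h) ∧
      (∀ l, (t l : ℝ) ≤
        16 * (n : ℝ) ^ 2 * (a : ℝ) ^ 2 * (frobSq (W l) / specNorm (W l) ^ 2) + 1) ∧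
      ∃ U ∈ weightNet n k h a t, ∀ x, ‖x‖ ≤ R → ∀ i,
        |a * γ / (8 * R) * net U x i - net W x i| ≤ γ / 4 := by
  set α := ∏ l, specNorm (W l) with hα
  have hα0 : 0 < α := Finset.prod_pos fun l _ => (specNorm_nonneg _).lt_of_ne' (hW l)
  have ha0 : 0 < a := by rw [ha]; exact Nat.ceil_pos.2 (by positivity)
  have ha0' : (0 : ℝ) < a := by exact_mod_cast ha0
  let V : Weights n k := fun l => (specNorm (W l))⁻¹ • W l
  have hV : ∀ l, specNorm (V l) ≤ 1 := fun l => by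
    simp only [V]
    rw [specNorm_smul, abs_of_nonneg (inv_nonneg.2 (specNorm_nonneg _)), inv_mul_cancel₀ (hW l)]
  obtain ⟨t, ht, ht', U, hU, hUV⟩ := exists_mem_weightNet hk hn hh ha0 V hV
  refine ⟨t, ht, fun l => ?_, U, hU, fun x hx i => ?_⟩
  · have e : frobSq (V l) = frobSq (W l) / specNorm (W l) ^ 2 := by
      simp only [V]; rw [frobSq_smul, inv_pow, inv_mul_eq_div]
    rw [← e]; exact ht' l
  -- `α'` is `α` rounded up to a multiple of `γ / (8 R)`. The scale error and the layer errors, the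
  -- latter being `α' * R / a`, contribute `γ / 8` each.
  · set α' : ℝ := a * γ / (8 * R) with hα'
    have hα'0 : 0 < α' := by positivity
    have hle1 : α ≤ α' := by
      have := Nat.le_ceil (8 * (R * α / γ))
      rw [← ha] at this
      rw [hα', le_div_iff₀ (by positivity)]
      calc α * (8 * R) = 8 * (R * α / γ) * γ := by field_simp
        _ ≤ a * γ := by gcongr
    have hle2 : α' - α ≤ γ / (8 * R) := by
      have := Nat.ceil_lt_add_one (a := 8 * (R * α / γ)) (by positivity)
      rw [← ha] at this
      have h2 : α' ≤ (8 * (R * α / γ) + 1) * γ / (8 * R) := by rw [hα']; gcongr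
      have h3 : (8 * (R * α / γ) + 1) * γ / (8 * R) = α + γ / (8 * R) := by field_simp
      linarith
    have hd : |net U x i - net V x i| ≤ 1 / a * R := by
      have h1 := l2_layer_sub_le (by positivity) hV hUV x n le_rfl
      have h2 := abs_apply_le_l2 (net U x - net V x) i
      refine h2.trans (h1.trans ?_)
      have := one_add_pow_sub_one_le hn ha0
      gcongr
    have hv : |net V x i| ≤ R :=
      (abs_apply_le_l2 (net V x) i).trans ((l2_layer_le hV x n le_rfl).trans hx)
    have hWi : net W x i = α * net V x i := congrFun (net_eq_prod_smul W hW x) i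
    have e : α' * net U x i - net W x i
        = α' * (net U x i - net V x i) + (α' - α) * net V x i := by rw [hWi]; ring
    rw [e]
    refine (abs_add_le _ _).trans ?_
    rw [abs_mul, abs_mul, abs_of_pos hα'0, abs_of_nonneg (sub_nonneg.2 hle1)]
    calc _ ≤ α' * (1 / a * R) + γ / (8 * R) * R := by
          gcongr
      _ = γ / 4 := by rw [hα']; field_simp; norm_num

/-! ### Concentration of conditional frequencies -/

/-- The number of sample points in `A`. -/
def sampleCount {Ω : Type*} {m : ℕ} (S : Fin m → Ω) (A : Set Ω) : ℝ :=
  ∑ q, A.indicator (fun _ => (1 : ℝ)) (S q)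

/-- The exponent of the exponential supermartingale for the frequency of `E` in `L`. -/
def expoTerm {Ω : Type*} (L E : Set Ω) (p lam : ℝ) (ω : Ω) : ℝ :=
  L.indicator (fun ω => lam * (p - E.indicator (fun _ => (1 : ℝ)) ω) - lam ^ 2 / 8) ω

lemma abs_expoTerm_le {Ω : Type*} (L E : Set Ω) (p lam : ℝ) (ω : Ω) :
    |expoTerm L E p lam ω| ≤ |lam| * (|p| + 1) + lam ^ 2 / 8 := by
  have h0 : 0 ≤ |lam| * (|p| + 1) + lam ^ 2 / 8 := by positivity
  by_cases hL : ω ∈ L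
  · simp only [expoTerm, Set.indicator_of_mem hL]
    refine (abs_sub _ _).trans ?_
    rw [abs_of_nonneg (by positivity : 0 ≤ lam ^ 2 / 8), abs_mul]
    gcongr
    refine (abs_sub _ _).trans ?_
    gcongr
    by_cases hE : ω ∈ E <;> simp [hE]
  · simpa [expoTerm, hL] using h0

lemma sum_expoTerm {Ω : Type*} {m : ℕ} (S : Fin m → Ω) (L E : Set Ω) (p lam : ℝ) :
    ∑ q, expoTerm L E p lam (S q) =
      sampleCount S L * (lam * p - lam ^ 2 / 8) - lam * sampleCount S (L ∩ E) := by
  rw [sampleCount, sampleCount, Finset.sum_mul, Finset.mul_sum, ← Finset.sum_sub_distrib]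
  refine Finset.sum_congr rfl fun q _ => ?_
  by_cases hL : S q ∈ L <;> by_cases hE : S q ∈ E <;> (simp [expoTerm, hL, hE]; try ring)

section Concentration

variable {Ω : Type*} [MeasurableSpace Ω]

lemma measurable_expoTerm {L E : Set Ω} (hL : MeasurableSet L) (hE : MeasurableSet E)
    (p lam : ℝ) : Measurable (expoTerm L E p lam) :=
  (((measurable_const.sub (measurable_const.indicator hE)).const_mul lam).sub_const _).indicator hL

lemma integrable_exp_expoTerm (D : Measure Ω) [IsFiniteMeasure D] {L E : Set Ω}
    (hL : MeasurableSet L) (hE : MeasurableSet E) (p lam : ℝ) :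
    Integrable (fun ω => Real.exp (expoTerm L E p lam ω)) D := by
  refine Integrable.of_bound
    (measurable_expoTerm hL hE p lam).exp.aestronglyMeasurable
    (Real.exp (|lam| * (|p| + 1) + lam ^ 2 / 8)) (ae_of_all _ fun ω => ?_)
  rw [Real.norm_eq_abs, Real.abs_exp]
  exact Real.exp_le_exp.2 ((le_abs_self _).trans (abs_expoTerm_le L E p lam ω))

/-- Hoeffding's lemma for an indicator function. -/
lemma integral_exp_indicator_le (Q : Measure Ω) [IsProbabilityMeasure Q] {E : Set Ω}
    (hE : MeasurableSet E) (lam : ℝ) :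
    ∫ ω, Real.exp (lam * (Q.real E - E.indicator (fun _ => (1 : ℝ)) ω)) ∂Q
      ≤ Real.exp (lam ^ 2 / 8) := by
  have hm : Measurable fun ω => - E.indicator (fun _ => (1 : ℝ)) ω :=
    (measurable_const.indicator hE).neg
  have h := (hasSubgaussianMGF_of_mem_Icc (μ := Q) (a := -1) (b := 0) hm.aemeasurable
    (ae_of_all _ fun ω => by by_cases hω : ω ∈ E <;> simp [hω])).mgf_le lam
  have e : ∫ ω, - E.indicator (fun _ => (1 : ℝ)) ω ∂Q = - Q.real E := by
    rw [integral_neg, integral_indicator_const _ hE, smul_eq_mul, mul_one]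
  rw [e] at h
  simp only [mgf] at h
  calc _ = ∫ ω, Real.exp (lam * (-E.indicator (fun _ => (1 : ℝ)) ω - -Q.real E)) ∂Q := by
        congr 1; ext ω; congr 2; ring
    _ ≤ _ := h
    _ = _ := by
      congr 1
      norm_num
      ring

/-- Off `L` the integrand is one, and on `L` Hoeffding's lemma for the conditional law bounds the
integral by `D.real L`. Points outside the class therefore cost nothing, and no conditioning on the
labels of the sample is needed. -/
lemma integral_exp_expoTerm_le (D : Measure Ω) [IsProbabilityMeasure D] {L E : Set Ω}
    (hL : MeasurableSet L) (hE : MeasurableSet E) (lam : ℝ) :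
    ∫ ω, Real.exp (expoTerm L E ((cond D L).real E) lam ω) ∂D ≤ 1 := by
  set p := (cond D L).real E with hp
  have hint := integrable_exp_expoTerm D hL hE p lam
  have hc : ∫ ω in Lᶜ, Real.exp (expoTerm L E p lam ω) ∂D = D.real Lᶜ := by
    rw [setIntegral_congr_fun (g := fun _ => (1 : ℝ)) hL.compl fun ω hω => by
      have : ω ∉ L := hω
      simp [expoTerm, this]]
    simp
  have hLe : ∫ ω in L, Real.exp (expoTerm L E p lam ω) ∂D ≤ D.real L := by
    by_cases h0 : D L = 0
    · rw [Measure.restrict_eq_zero.2 h0]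
      simp
    · have := cond_isProbabilityMeasure h0
      have h1 := integral_exp_indicator_le (cond D L) hE lam
      rw [← hp] at h1
      rw [ProbabilityTheory.cond, integral_smul_measure, ENNReal.toReal_inv, smul_eq_mul] at h1
      have hpos : 0 < (D L).toReal := ENNReal.toReal_pos h0 (measure_ne_top _ _)
      rw [inv_mul_le_iff₀ hpos] at h1
      calc ∫ ω in L, Real.exp (expoTerm L E p lam ω) ∂D
          = ∫ ω in L, Real.exp (lam * (p - E.indicator (fun _ => (1 : ℝ)) ω))
              * Real.exp (-(lam ^ 2 / 8)) ∂D := by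
            refine setIntegral_congr_fun hL fun ω hω => ?_
            simp only [expoTerm, Set.indicator_of_mem hω]
            rw [← Real.exp_add, sub_eq_add_neg]
        _ = (∫ ω in L, Real.exp (lam * (p - E.indicator (fun _ => (1 : ℝ)) ω)) ∂D)
              * Real.exp (-(lam ^ 2 / 8)) := integral_mul_const _ _
        _ ≤ ((D L).toReal * Real.exp (lam ^ 2 / 8)) * Real.exp (-(lam ^ 2 / 8)) := by gcongr
        _ = D.real L := by
            rw [mul_assoc, ← Real.exp_add]; simp [Measure.real]
  rw [← integral_add_compl hL hint, hc]
  have := probReal_add_probReal_compl (μ := D) hL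
  linarith

/-- Markov's inequality for the product of the exponentials, whose mean factorizes by independence.
-/
lemma measure_expoTerm_ge_le (D : Measure Ω) [IsProbabilityMeasure D] {L E : Set Ω}
    (hL : MeasurableSet L) (hE : MeasurableSet E) (m : ℕ) (lam x : ℝ) :
    (Measure.pi fun _ : Fin m => D)
      {S | x ≤ ∑ q, expoTerm L E ((cond D L).real E) lam (S q)} ≤ ENNReal.ofReal (Real.exp (-x)) := by
  set p := (cond D L).real E with hp
  have hint : Integrable (fun S : Fin m → Ω => ∏ q, Real.exp (expoTerm L E p lam (S q)))
      (Measure.pi fun _ : Fin m => D) :=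
    Integrable.fintype_prod fun _ => integrable_exp_expoTerm D hL hE p lam
  have h1 : ∫ S, ∏ q, Real.exp (expoTerm L E p lam (S q)) ∂(Measure.pi fun _ : Fin m => D) ≤ 1 := by
    rw [integral_fintype_prod_eq_prod (fun _ ω => Real.exp (expoTerm L E p lam ω))]
    exact Finset.prod_le_one (fun _ _ => integral_nonneg fun _ => (Real.exp_pos _).le)
      fun _ _ => integral_exp_expoTerm_le D hL hE lam
  have h2 := mul_meas_ge_le_integral_of_nonneg
    (ae_of_all _ fun S => Finset.prod_nonneg fun q _ => (Real.exp_pos _).le) hint (Real.exp x)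
  have h3 : {S : Fin m → Ω | Real.exp x ≤ ∏ q, Real.exp (expoTerm L E p lam (S q))}
      = {S | x ≤ ∑ q, expoTerm L E p lam (S q)} := by
    ext S
    simp only [Set.mem_ofPred_eq, ← Real.exp_sum, Real.exp_le_exp]
  rw [h3] at h2
  rw [ENNReal.le_ofReal_iff_toReal_le (measure_ne_top _ _) (Real.exp_pos _).le, Real.exp_neg]
  rw [← one_div, le_div_iff₀ (Real.exp_pos _), mul_comm]
  exact h2.trans h1

lemma measure_deviation_le (D : Measure Ω) [IsProbabilityMeasure D] {L E : Set Ω}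
    (hL : MeasurableSet L) (hE : MeasurableSet E) (m : ℕ) {s x : ℝ} (hs : 0 < s) (hx : 0 < x) :
    (Measure.pi fun _ : Fin m => D)
      {S | sampleCount S L = s ∧
        sampleCount S (L ∩ E) + √(s * x / 2) < s * (cond D L).real E} ≤
      ENNReal.ofReal (Real.exp (-x)) := by
  -- Once the count is fixed at `s`, `√(8 x / s)` is the optimal parameter: the linear part of the
  -- exponent is at least `2 x`, and the quadratic part takes away exactly `x`.
  refine (measure_mono fun S hS => ?_).trans
    (measure_expoTerm_ge_le D hL hE m (√(8 * x / s)) x)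
  obtain ⟨h1, h2⟩ := hS
  simp only [Set.mem_ofPred_eq]
  rw [sum_expoTerm, h1]
  have e1 : √(8 * x / s) ^ 2 = 8 * x / s := Real.sq_sqrt (by positivity)
  have e2 : √(8 * x / s) * √(s * x / 2) = 2 * x := by
    rw [← Real.sqrt_mul (by positivity)]
    rw [show 8 * x / s * (s * x / 2) = (2 * x) ^ 2 by field_simp; ring]
    exact Real.sqrt_sq (by positivity)
  have e3 : s * (√(8 * x / s) ^ 2 / 8) = x := by rw [e1]; field_simp
  have e4 : √(8 * x / s) * (sampleCount S (L ∩ E) + √(s * x / 2)) ≤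
      √(8 * x / s) * (s * (cond D L).real E) := by gcongr
  nlinarith

lemma tsum_inv_mul_succ_le_one :
    ∑' s : ℕ, ENNReal.ofReal (1 / ((s + 1 : ℝ) * (s + 2))) ≤ 1 := by
  refine ENNReal.tsum_le_of_sum_range_le fun N => ?_
  rw [← ENNReal.ofReal_sum_of_nonneg fun s _ => by positivity]
  rw [ENNReal.ofReal_le_one]
  have : ∑ s ∈ Finset.range N, 1 / ((s + 1 : ℝ) * (s + 2)) = 1 - 1 / (N + 1) := by
    induction N with
    | zero => simp
    | succ N ih =>
      rw [Finset.sum_range_succ, ih]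
      push_cast
      field_simp
      ring
  rw [this]
  have : (0 : ℝ) ≤ 1 / (N + 1) := by positivity
  linarith

/-- Simultaneously for all classes and all events of a countable family with weights `w`, the
conditional probability is bounded by the frequency in the class. -/
lemma measure_exists_deviation_le (D : Measure Ω) [IsProbabilityMeasure D] {ι : Type*}
    [Countable ι] {w : ι → ℝ} (hw : ∀ i, 0 < w i) (hw1 : ∀ i, w i ≤ 1)
    (hws : ∑' i, ENNReal.ofReal (w i) ≤ 1) {c : ℕ} (hc : 0 < c) {L : Fin c → Set Ω}
    (hL : ∀ j, MeasurableSet (L j)) {E : ι → Fin c → Set Ω} (hE : ∀ i j, MeasurableSet (E i j))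
    {δ : ℝ} (hδ : 0 < δ) (hδ1 : δ < 1) (m : ℕ) :
    (Measure.pi fun _ : Fin m => D)
      {S | ∃ i j, ∃ s : ℕ, 0 < s ∧ sampleCount S (L j) = s ∧
        sampleCount S (L j ∩ E i j) + √(s * Real.log (c * (s * (s + 1)) / (δ * w i)) / 2)
          < s * (cond D (L j)).real (E i j)} ≤ ENNReal.ofReal δ := by
  have hc' : (1 : ℝ) ≤ c := by exact_mod_cast hc
  -- The count is `s + 1`, so that the index starts at zero. Each bad set receives the share `δ * w
  -- i / (c (s + 1) (s + 2))` of the failure probability.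
  let bad : ι → Fin c → ℕ → Set (Fin m → Ω) := fun i j s =>
    {S | sampleCount S (L j) = ((s + 1 : ℕ) : ℝ) ∧
      sampleCount S (L j ∩ E i j) + √(((s + 1 : ℕ) : ℝ) *
        Real.log (c * ((s + 1 : ℝ) * (s + 2)) / (δ * w i)) / 2)
          < ((s + 1 : ℕ) : ℝ) * (cond D (L j)).real (E i j)}
  have hbad : ∀ i j s, (Measure.pi fun _ : Fin m => D) (bad i j s) ≤
      ENNReal.ofReal (w i) * (ENNReal.ofReal (δ / c) *
        ENNReal.ofReal (1 / ((s + 1 : ℝ) * (s + 2)))) := by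
    intro i j s
    have hwi := hw i
    have h1 : 1 < c * ((s + 1 : ℝ) * (s + 2)) / (δ * w i) := by
      rw [one_lt_div (by positivity)]
      have a1 : δ * w i < 1 := by nlinarith [hw1 i]
      have a2 : (1 : ℝ) ≤ (s + 1 : ℝ) * (s + 2) := by
        have : (0 : ℝ) ≤ s := by positivity
        nlinarith
      nlinarith
    refine (measure_deviation_le D (hL j) (hE i j) m (by positivity) (Real.log_pos h1)).trans ?_
    rw [Real.exp_neg, Real.exp_log (by positivity), ← ENNReal.ofReal_mul (by positivity),
      ← ENNReal.ofReal_mul hwi.le]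
    refine ENNReal.ofReal_le_ofReal (le_of_eq ?_)
    field_simp
  calc _ ≤ (Measure.pi fun _ : Fin m => D) (⋃ i, ⋃ j, ⋃ s, bad i j s) := by
        refine measure_mono ?_
        rintro S ⟨i, j, s, hs, h1, h2⟩
        obtain ⟨s, rfl⟩ : ∃ s', s = s' + 1 := ⟨s - 1, by omega⟩
        simp only [Set.mem_iUnion]
        refine ⟨i, j, s, h1, ?_⟩
        convert h2 using 6
        push_cast
        ring
    _ ≤ ∑' i, ∑' _j : Fin c, ∑' s : ℕ, ENNReal.ofReal (w i) * (ENNReal.ofReal (δ / c) *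
        ENNReal.ofReal (1 / ((s + 1 : ℝ) * (s + 2)))) := by
        refine (measure_iUnion_le _).trans (ENNReal.tsum_le_tsum fun i => ?_)
        refine (measure_iUnion_le _).trans (ENNReal.tsum_le_tsum fun j => ?_)
        exact (measure_iUnion_le _).trans (ENNReal.tsum_le_tsum fun s => hbad i j s)
    _ = (∑' i, ENNReal.ofReal (w i)) * (∑' _j : Fin c, ENNReal.ofReal (δ / c) *
          ∑' s : ℕ, ENNReal.ofReal (1 / ((s + 1 : ℝ) * (s + 2)))) := by
        simp only [ENNReal.tsum_mul_left, ENNReal.tsum_mul_right]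
    _ ≤ 1 * (∑' _j : Fin c, ENNReal.ofReal (δ / c) * 1) := by
        gcongr
        exact tsum_inv_mul_succ_le_one
    _ = ENNReal.ofReal δ := by
        rw [one_mul, mul_one, tsum_fintype, Finset.sum_const, Finset.card_univ, Fintype.card_fin,
          nsmul_eq_mul, ← ENNReal.ofReal_natCast, ← ENNReal.ofReal_mul (by positivity)]
        congr 1
        field_simp

end Concentration

/-! ### Margins and confusion matrices -/

/-- The margin of the scores `z` at the label `j` is at most `θ`. -/
def MarginLE {c : ℕ} (z : Fin c → ℝ) (j : Fin c) (θ : ℝ) : Prop := ∃ i, i ≠ j ∧ z j ≤ θ + z i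

lemma MarginLE.margin_le {c : ℕ} {z : Fin c → ℝ} {j : Fin c} {θ : ℝ} (h : MarginLE z j θ) :
    margin z j ≤ θ := by
  obtain ⟨i, hi, hz⟩ := h
  have := le_ciSup (f := fun i : {i : Fin c // i ≠ j} => z i) (Set.finite_range _).bddAbove ⟨i, hi⟩
  simp only at this
  unfold margin
  linarith

/-- A wrong label `i₀` must exist: without one the supremum in `margin` is over an empty family and
takes the default value `0`. -/
lemma marginLE_of_margin_le {c : ℕ} {z : Fin c → ℝ} {j i₀ : Fin c} (hi₀ : i₀ ≠ j) {θ : ℝ}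
    (h : margin z j ≤ θ) : MarginLE z j θ := by
  have : Nonempty {i : Fin c // i ≠ j} := ⟨⟨i₀, hi₀⟩⟩
  obtain ⟨i, hi⟩ := exists_eq_ciSup_of_finite (f := fun i : {i : Fin c // i ≠ j} => z i)
  unfold margin at h
  exact ⟨i, i.2, by linarith⟩

lemma MarginLE.mono {c : ℕ} {z : Fin c → ℝ} {j : Fin c} {θ θ' : ℝ} (h : MarginLE z j θ)
    (hθ : θ ≤ θ') : MarginLE z j θ' := by
  obtain ⟨i, hi, hz⟩ := h
  exact ⟨i, hi, by linarith⟩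

lemma MarginLE.of_abs_sub_le {c : ℕ} {z z' : Fin c → ℝ} {j : Fin c} {θ e : ℝ}
    (h : MarginLE z j θ) (hz : ∀ i, |z' i - z i| ≤ e) : MarginLE z' j (θ + 2 * e) := by
  obtain ⟨i, hi, hzi⟩ := h
  have h1 := abs_le.1 (hz i)
  have h2 := abs_le.1 (hz j)
  exact ⟨i, hi, by linarith [h1.1, h2.2]⟩

lemma Predicts.marginLE {c : ℕ} {z : Fin c → ℝ} {j i : Fin c} (h : Predicts z j i)
    (hij : i ≠ j) : MarginLE z j 0 :=
  ⟨i, hij, by simpa using h.1 j⟩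

lemma Predicts.unique {c : ℕ} {z : Fin c → ℝ} {j i i' : Fin c} (hi : i ≠ j) (hi' : i' ≠ j)
    (h : Predicts z j i) (h' : Predicts z j i') : i = i' := by
  rcases lt_trichotomy i i' with hlt | heq | hlt
  · exact absurd (h'.2 i hi hlt) (not_lt.2 (h.1 i'))
  · exact heq
  · exact absurd (h.2 i' hi' hlt) (not_lt.2 (h'.1 i))

lemma exists_isArgmaxWrong {c : ℕ} (z : Fin c → ℝ) {j i₀ : Fin c} (hi₀ : i₀ ≠ j) :
    ∃ i, IsArgmaxWrong z j i := by
  obtain ⟨i₁, h1, h2⟩ := Finset.exists_max_image (Finset.univ.filter fun i => i ≠ j) z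
    ⟨i₀, by simpa using hi₀⟩
  obtain ⟨i, h3, h4⟩ := Finset.exists_min_image
    (Finset.univ.filter fun i => i ≠ j ∧ z i₁ ≤ z i) id ⟨i₁, by simpa using h1⟩
  simp only [Finset.mem_filter, Finset.mem_univ, true_and, id] at h1 h2 h3 h4
  refine ⟨i, h3.1, fun i' hi' => (h2 i' hi').trans h3.2, fun i' hi' hlt => ?_⟩
  by_contra hge
  exact absurd (h4 i' ⟨hi', h3.2.trans (not_lt.1 hge)⟩) (not_le.2 hlt)

lemma measurableSet_marginLE {X : Type*} [MeasurableSpace X] {c : ℕ} {f : X → Fin c → ℝ}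
    (hf : Measurable f) (j : Fin c) (θ : ℝ) : MeasurableSet {x | MarginLE (f x) j θ} := by
  have hfi : ∀ i, Measurable fun x => f x i := fun i => (measurable_pi_apply i).comp hf
  simp only [MarginLE, Set.ofPred_exists, Set.ofPred_and]
  exact MeasurableSet.iUnion fun i => (MeasurableSet.const _).inter
    (measurableSet_le (hfi j) ((hfi i).const_add θ))

lemma isClosed_marginLE {X : Type*} [TopologicalSpace X] {c : ℕ} {f : X → Fin c → ℝ}
    (hf : Continuous f) (j : Fin c) (θ : ℝ) : IsClosed {x | MarginLE (f x) j θ} := by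
  have hfi : ∀ i, Continuous fun x => f x i := fun i => (continuous_apply i).comp hf
  simp only [MarginLE, Set.ofPred_exists, Set.ofPred_and]
  exact isClosed_iUnion_of_finite fun i => isClosed_const.inter
    (isClosed_le (hfi j) (continuous_const.add (hfi i)))

lemma measurableSet_predicts {X : Type*} [MeasurableSpace X] {c : ℕ} {f : X → Fin c → ℝ}
    (hf : Measurable f) (j i : Fin c) : MeasurableSet {x | Predicts (f x) j i} := by
  have hfi : ∀ i, Measurable fun x => f x i := fun i => (measurable_pi_apply i).comp hf
  simp only [Predicts, Set.ofPred_forall, Set.ofPred_and]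
  exact (MeasurableSet.iInter fun i' => measurableSet_le (hfi i') (hfi i)).inter
    (MeasurableSet.iInter fun i' => MeasurableSet.iInter fun _ => MeasurableSet.iInter fun _ =>
      measurableSet_lt (hfi i') (hfi i))

lemma measurableSet_label {X : Type*} [MeasurableSpace X] {c : ℕ} (j : Fin c) :
    MeasurableSet {p : X × Fin c | p.2 = j} :=
  measurable_snd (measurableSet_singleton j)

lemma cond_advMeasure_real {X : Type*} [MeasurableSpace X] {c : ℕ} {A : X × Fin c → X}
    (hA : Measurable A) (D : Measure (X × Fin c)) (j : Fin c) {s : Set (X × Fin c)}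
    (hs : MeasurableSet s) :
    (ProbabilityTheory.cond (advMeasure A D) {p | p.2 = j}).real s =
      (ProbabilityTheory.cond D {p | p.2 = j}).real {p | (A p, p.2) ∈ s} := by
  have hT : Measurable fun p : X × Fin c => (A p, p.2) := hA.prodMk measurable_snd
  have hj := measurableSet_label (X := X) j
  rw [Measure.real, Measure.real, cond_apply hj, cond_apply hj, advMeasure,
    Measure.map_apply hT hj, Measure.map_apply hT (hj.inter hs)]
  rfl

/-- The tie-breaking rule makes the events of one column disjoint, so their probabilities add up to
that of a union contained in the error event. -/
lemma sum_abs_trueConfusion_le {X : Type*} [MeasurableSpace X] {c : ℕ} {f : X → Fin c → ℝ}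
    (hf : Measurable f) {A : X × Fin c → X} (hA : Measurable A) (D : Measure (X × Fin c))
    [IsProbabilityMeasure D] (j : Fin c) :
    ∑ i, |trueConfusion f (advMeasure A D) i j| ≤
      (ProbabilityTheory.cond D {p | p.2 = j}).real {p | MarginLE (f (A p)) j 0} := by
  have hfA : Measurable fun p => f (A p) := hf.comp hA
  calc ∑ i, |trueConfusion f (advMeasure A D) i j|
      = ∑ i, if i = j then 0 else
          (ProbabilityTheory.cond D {p | p.2 = j}).real {p | Predicts (f (A p)) j i} := by
        refine Finset.sum_congr rfl fun i _ => ?_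
        simp only [trueConfusion, Matrix.of_apply]
        split_ifs with hij
        · exact abs_zero
        · rw [abs_of_nonneg measureReal_nonneg]
          exact cond_advMeasure_real hA D j
            (measurableSet_predicts (hf.comp measurable_fst) j i)
    _ = ∑ i ∈ Finset.univ.filter fun i => i ≠ j,
          (ProbabilityTheory.cond D {p | p.2 = j}).real {p | Predicts (f (A p)) j i} := by
        rw [Finset.sum_filter]
        refine Finset.sum_congr rfl fun i _ => ?_
        by_cases hij : i = j <;> simp [hij]
    _ = (ProbabilityTheory.cond D {p | p.2 = j}).real
          (⋃ i ∈ Finset.univ.filter fun i => i ≠ j, {p | Predicts (f (A p)) j i}) := by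
        refine (measureReal_biUnion_finset ?_ fun i _ => measurableSet_predicts hfA j i).symm
        intro i hi i' hi' hne
        refine Set.disjoint_left.2 fun p hp hp' => hne ?_
        exact Predicts.unique (by simpa using hi) (by simpa using hi') hp hp'
    _ ≤ _ := by
        refine measureReal_mono ?_
        intro p hp
        simp only [Set.mem_iUnion, Finset.mem_filter, Finset.mem_univ, true_and] at hp
        obtain ⟨i, hi, hp⟩ := hp
        exact Predicts.marginLE hp hi

lemma sampleCount_label {X : Type*} {m c : ℕ} (S : Fin m → X × Fin c) (j : Fin c) :
    sampleCount S {p | p.2 = j} = classCount S j := by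
  simp [sampleCount, classCount, Set.indicator_apply, Finset.sum_boole]

lemma sampleCount_mono {Ω Ω' : Type*} {m : ℕ} {S : Fin m → Ω} {S' : Fin m → Ω'} {A : Set Ω}
    {A' : Set Ω'} (h : ∀ q, S q ∈ A → S' q ∈ A') : sampleCount S A ≤ sampleCount S' A' := by
  refine Finset.sum_le_sum fun q _ => ?_
  by_cases hq : S q ∈ A
  · simp [hq, h q hq]
  · rw [Set.indicator_of_notMem hq]
    exact Set.indicator_nonneg (fun _ _ => zero_le_one) _

lemma sampleCount_div_le_sum_abs_marginConfusion {X : Type*} {m c : ℕ} (γ : ℝ)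
    (f : X → Fin c → ℝ) (S : Fin m → X × Fin c) {j i₀ : Fin c} (hi₀ : i₀ ≠ j) :
    sampleCount S ({p | p.2 = j} ∩ {p | MarginLE (f p.1) j γ}) / classCount S j ≤
      ∑ i, |marginConfusion γ f S i j| := by
  classical
  have hnn : ∀ i, ∀ q, 0 ≤ (1 / (classCount S j : ℝ)) *
      (if f (S q).1 (S q).2 ≤ γ + f (S q).1 i ∧ (S q).2 = j ∧
        IsArgmaxWrong (f (S q).1) (S q).2 i then 1 else 0) := fun i q => by
    split_ifs <;> positivity
  calc sampleCount S ({p | p.2 = j} ∩ {p | MarginLE (f p.1) j γ}) / classCount S j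
      = ∑ q, (1 / (classCount S j : ℝ)) *
          ({p | p.2 = j} ∩ {p | MarginLE (f p.1) j γ}).indicator (fun _ => 1) (S q) := by
        rw [sampleCount, ← Finset.mul_sum, one_div, inv_mul_eq_div]
    _ ≤ ∑ q, ∑ i, if i = j then 0 else (1 / (classCount S j : ℝ)) *
          (if f (S q).1 (S q).2 ≤ γ + f (S q).1 i ∧ (S q).2 = j ∧
            IsArgmaxWrong (f (S q).1) (S q).2 i then 1 else 0) := by
        refine Finset.sum_le_sum fun q _ => ?_
        have hnn' : ∀ i ∈ Finset.univ, 0 ≤ if i = j then 0 else (1 / (classCount S j : ℝ)) *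
            (if f (S q).1 (S q).2 ≤ γ + f (S q).1 i ∧ (S q).2 = j ∧
            IsArgmaxWrong (f (S q).1) (S q).2 i then 1 else 0) := fun i _ => by
          split_ifs <;> positivity
        by_cases hq : S q ∈ {p | p.2 = j} ∩ {p | MarginLE (f p.1) j γ}
        · rw [Set.indicator_of_mem hq]
          obtain ⟨h1, i', hi', h2⟩ := hq
          have h1' : (S q).2 = j := h1
          obtain ⟨i, hi⟩ := exists_isArgmaxWrong (f (S q).1) hi₀
          refine le_trans (le_of_eq ?_) (Finset.single_le_sum hnn' (Finset.mem_univ i))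
          rw [if_neg hi.1, if_pos]
          rw [h1']
          exact ⟨h2.trans (by linarith [hi.2.1 i' hi']), rfl, hi⟩
        · rw [Set.indicator_of_notMem hq, mul_zero]
          exact Finset.sum_nonneg hnn'
    _ = ∑ i, |marginConfusion γ f S i j| := by
        rw [Finset.sum_comm]
        refine Finset.sum_congr rfl fun i _ => ?_
        simp only [marginConfusion, Matrix.of_apply]
        split_ifs with hij
        · simp
        · rw [abs_of_nonneg (Finset.sum_nonneg fun q _ => hnn i q)]

lemma sum_abs_le_sqrt_mul_specNorm {p q : ℕ} (M : Matrix (Fin p) (Fin q) ℝ) (j : Fin q) :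
    ∑ i, |M i j| ≤ √p * specNorm M := by
  have h1 := l2_mulVec_le M (Pi.single j 1)
  have h2 : l2 (Pi.single j 1 : Fin q → ℝ) = 1 := by simp [l2]
  rw [h2, mul_one, Matrix.mulVec_single_one] at h1
  refine le_trans ?_ (mul_le_mul_of_nonneg_left h1 (Real.sqrt_nonneg _))
  refine le_of_sq_le_sq ?_ (mul_nonneg (Real.sqrt_nonneg _) (l2_nonneg _))
  rw [mul_pow, Real.sq_sqrt (Nat.cast_nonneg _), l2_sq]
  have := sq_sum_le_card_mul_sum_sq (s := Finset.univ) (f := fun i => |M i j|)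
  simpa using this

lemma colNorm_le {p q : ℕ} {M : Matrix (Fin p) (Fin q) ℝ} {a : ℝ} (ha : 0 ≤ a)
    (h : ∀ j, ∑ i, |M i j| ≤ a) : colNorm M ≤ a :=
  Real.iSup_le h ha

lemma complexity_nonneg {n : ℕ} {k : ℕ → ℕ} (h : ℕ) (B ε : ℝ) (W : Weights n k) :
    0 ≤ complexity h B ε W := by
  have h1 : 0 ≤ Real.log (n * h) := by exact_mod_cast Real.log_natCast_nonneg (n * h)
  have h2 : 0 ≤ ∏ l, specNorm (W l) ^ 2 := Finset.prod_nonneg fun _ _ => sq_nonneg _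
  have h3 : 0 ≤ ∑ l, frobSq (W l) / specNorm (W l) ^ 2 :=
    Finset.sum_nonneg fun _ _ => div_nonneg (frobSq_nonneg _) (sq_nonneg _)
  unfold complexity
  positivity

/-! ### From class-wise deviations to the bound -/

/-- With at most one class there are no errors. -/
lemma robustBound_of_subsingleton {n m : ℕ} {k : ℕ → ℕ} (hk : k n ≤ 1) {C ν : ℝ} (hC : 0 ≤ C)
    (hν : 0 ≤ ν) (h : ℕ) {B ε δ γ : ℝ}
    (D : Measure (EuclideanSpace ℝ (Fin (k 0)) × Fin (k n)))
    (S : Fin m → EuclideanSpace ℝ (Fin (k 0)) × Fin (k n)) (W : Weights n k)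
    (A : EuclideanSpace ℝ (Fin (k 0)) × Fin (k n) → EuclideanSpace ℝ (Fin (k 0))) :
    RobustBound C ν h B ε δ γ D S W A := by
  have h0 : colNorm (trueConfusion (net W) (advMeasure A D)) ≤ 0 := by
    refine colNorm_le le_rfl fun j => le_of_eq (Finset.sum_eq_zero fun i _ => ?_)
    have : i = j := Fin.ext (by omega)
    simp [trueConfusion, this]
  have hs := specNorm_nonneg (marginConfusion γ (net W) (advSample A S))
  constructor <;> refine h0.trans ?_ <;> positivity

/-- Replaces the individual class count `s` by the minimum `m`. The argument of the logarithm is at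
most `s ^ 4 / δ`, and `log s` lies below the tangent line of `log` at `m`; `m ≥ 9 > e` makes the
remaining coefficient nonnegative. -/
lemma log_classCount_le {c s m : ℕ} {δ : ℝ} (hδ : 0 < δ) (hδ1 : δ < 1) (hcm : 8 * c < m)
    (hc : 0 < c) (hms : m ≤ s) :
    Real.log (c * (s * (s + 1)) / δ) / s ≤ 8 * Real.log (m / δ) / m := by
  have hm' : (9 : ℝ) ≤ m := by exact_mod_cast (by omega : 9 ≤ m)
  have hs' : (m : ℝ) ≤ s := by exact_mod_cast hms
  have hcm' : (c : ℝ) ≤ s := by exact_mod_cast (by omega : c ≤ s)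
  have hc' : (0 : ℝ) < c := by exact_mod_cast hc
  have hs0 : (0 : ℝ) < s := by linarith
  have hm0 : (0 : ℝ) < m := by linarith
  have hld : 0 < -Real.log δ := by have := Real.log_neg hδ hδ1; linarith
  have h1 : Real.log (c * (s * (s + 1)) / δ) ≤ 4 * Real.log s - Real.log δ := by
    rw [Real.log_div (by positivity) hδ.ne']
    have : Real.log (c * (s * (s + 1))) ≤ Real.log ((s : ℝ) ^ 4) := by
      refine Real.log_le_log (by positivity) ?_
      calc (c : ℝ) * (s * (s + 1)) ≤ s * (s * (s * s)) := by gcongr; nlinarith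
        _ = (s : ℝ) ^ 4 := by ring
    rw [Real.log_pow] at this
    push_cast at this
    linarith
  have h2 : Real.log s ≤ Real.log m + (s / m - 1) := by
    have := Real.log_le_sub_one_of_pos (show (0 : ℝ) < s / m by positivity)
    rw [Real.log_div hs0.ne' hm0.ne'] at this
    linarith
  have h3 : 1 ≤ Real.log m := by
    rw [Real.le_log_iff_exp_le hm0]
    have := Real.exp_one_lt_d9
    linarith
  rw [div_le_div_iff₀ hs0 hm0, Real.log_div hm0.ne' hδ.ne']
  have h4 : Real.log (c * (s * (s + 1)) / δ) * m
      ≤ (4 * (Real.log m + (s / m - 1)) - Real.log δ) * m := by gcongr; linarith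
  have h5 : (4 * (Real.log m + (s / m - 1)) - Real.log δ) * m
      = (4 * Real.log m - 4 - Real.log δ) * m + 4 * s := by field_simp; ring
  have h6 : (4 * Real.log m - 4 - Real.log δ) * m ≤ (4 * Real.log m - 4 - Real.log δ) * s := by
    gcongr
    linarith
  nlinarith

/-- The bound follows from deviation bounds for all classes. -/
lemma robustBound_of_deviation {n m h : ℕ} {k : ℕ → ℕ} (hn : 0 < n) (hk : 2 ≤ k n) {B ε δ γ : ℝ}
    (hδ : 0 < δ) (hδ1 : δ < 1) (hγ : 0 < γ)
    (D : Measure (EuclideanSpace ℝ (Fin (k 0)) × Fin (k n))) [IsProbabilityMeasure D]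
    (S : Fin m → EuclideanSpace ℝ (Fin (k 0)) × Fin (k n)) (hS : 8 * k n < minClassCount S)
    (W : Weights n k)
    {A : EuclideanSpace ℝ (Fin (k 0)) × Fin (k n) → EuclideanSpace ℝ (Fin (k 0))}
    (hA : Measurable A) {Λ : ℝ} (hΛ : Λ ≤ 40000 * (complexity h B ε W / γ ^ 2))
    (hdev : ∀ j, classCount S j *
        (ProbabilityTheory.cond D {p | p.2 = j}).real {p | MarginLE (net W (A p)) j 0} ≤
      sampleCount (advSample A S) ({p | p.2 = j} ∩ {p | MarginLE (net W p.1) j γ}) +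
        √(classCount S j *
          (Λ + Real.log (k n * (classCount S j * (classCount S j + 1)) / δ)) / 2)) :
    RobustBound 200 (√(k n)) h B ε δ γ D S W A := by
  have hcm : (8 * k n : ℝ) < minClassCount S := by exact_mod_cast hS
  have hc' : (2 : ℝ) ≤ k n := by exact_mod_cast hk
  have hn' : (1 : ℝ) ≤ n := by exact_mod_cast hn
  have hsp := specNorm_nonneg (marginConfusion γ (net W) (advSample A S))
  set M : ℝ := (minClassCount S : ℝ) with hM
  set Φ := complexity h B ε W with hΦ
  have hΦ0 : 0 ≤ Φ := complexity_nonneg h B ε W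
  set Lg := Real.log (n * M / δ) with hLg
  have hM0 : 0 < M := by linarith
  have hLg1 : Real.log (M / δ) ≤ Lg := by
    refine Real.log_le_log (by positivity) ?_
    gcongr
    nlinarith
  have hLg0 : 0 ≤ Lg := by
    refine le_trans (Real.log_nonneg ?_) hLg1
    rw [le_div_iff₀ hδ]
    linarith
  have first : colNorm (trueConfusion (net W) (advMeasure A D)) ≤
      √(k n) * specNorm (marginConfusion γ (net W) (advSample A S)) +
        200 * √((k n : ℝ) * k n / (M - 8 * k n) * (Φ / γ ^ 2 + Lg)) := by
    refine colNorm_le (by positivity) fun j => ?_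
    obtain ⟨i₀, hi₀⟩ : ∃ i₀, i₀ ≠ j := by
      have : Nontrivial (Fin (k n)) := Fin.nontrivial_iff_two_le.2 hk
      exact exists_ne j
    refine (sum_abs_trueConfusion_le (continuous_net W).measurable hA D j).trans ?_
    have hcc : classCount (advSample A S) j = classCount S j := rfl
    have hemp := (sampleCount_div_le_sum_abs_marginConfusion γ (net W) (advSample A S) hi₀).trans
      (sum_abs_le_sqrt_mul_specNorm _ j)
    rw [hcc] at hemp
    have hmin : minClassCount S ≤ classCount S j := ciInf_le' _ j
    have hmin' : M ≤ (classCount S j : ℝ) := Nat.cast_le.2 hmin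
    have hd := hdev j
    have hlog := log_classCount_le hδ hδ1 hS (by omega) hmin
    set s : ℝ := (classCount S j : ℝ) with hs
    have hs0 : 0 < s := by linarith
    have hd' := (le_div_iff₀' hs0).2 hd
    rw [add_div] at hd'
    refine hd'.trans (add_le_add hemp ?_)
    rw [div_le_iff₀ hs0]
    refine Real.sqrt_le_iff.2 ⟨by positivity, ?_⟩
    have hrhs : 0 ≤ (k n : ℝ) * k n / (M - 8 * k n) * (Φ / γ ^ 2 + Lg) := by
      have : 0 < M - 8 * k n := by linarith
      positivity
    have e1 : (200 * √((k n : ℝ) * k n / (M - 8 * k n) * (Φ / γ ^ 2 + Lg)) * s) ^ 2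
        = 40000 * ((k n : ℝ) * k n / (M - 8 * k n) * (Φ / γ ^ 2 + Lg)) * s ^ 2 := by
      rw [mul_pow, mul_pow, Real.sq_sqrt hrhs]; norm_num
    rw [e1]
    -- The factor `ν² d_y = (k n)²` and the subtracted `8 * k n` of the claimed bound are pure slack
    -- here.
    have h1 : 1 / M ≤ (k n : ℝ) * k n / (M - 8 * k n) := by
      rw [div_le_div_iff₀ hM0 (by linarith)]
      nlinarith [mul_nonneg (show (0 : ℝ) ≤ k n * k n - 1 by nlinarith) hM0.le]
    have h2 : Real.log (k n * (s * (s + 1)) / δ) ≤ 8 * Lg / M * s := by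
      rw [← div_le_iff₀ hs0]
      refine hlog.trans ?_
      gcongr
    have h3 : Λ ≤ 40000 * (Φ / γ ^ 2) / M * s := by
      refine hΛ.trans ?_
      rw [div_mul_eq_mul_div, le_div_iff₀ hM0]
      gcongr
    calc s * (Λ + Real.log (k n * (s * (s + 1)) / δ)) / 2
        ≤ s * (40000 * (Φ / γ ^ 2) / M * s + 8 * Lg / M * s) / 2 := by gcongr
      _ = (20000 * (Φ / γ ^ 2) + 4 * Lg) * (1 / M) * s ^ 2 := by field_simp; ring
      _ ≤ (40000 * (Φ / γ ^ 2) + 40000 * Lg) * ((k n : ℝ) * k n / (M - 8 * k n)) * s ^ 2 := by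
          have : 0 ≤ Φ / γ ^ 2 := by positivity
          gcongr <;> norm_num
      _ = _ := by ring
  have second : colNorm (trueConfusion (net W) (advMeasure A D)) ≤
      √(k n) * specNorm (marginConfusion γ (net W) (advSample A S)) +
        200 * max 1 γ * √((k n : ℝ) * k n / ((M - 8 * k n) * γ ^ 2) * (Φ + Lg)) := by
    -- The second bound is weaker than the first: moving `max 1 γ` under the root multiplies `Φ /
    -- γ²` by `max 1 γ ^ 2 ≥ 1` and `Lg` by `max 1 γ ^ 2 / γ ^ 2 ≥ 1`.
    refine first.trans (add_le_add le_rfl ?_)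
    rw [mul_assoc]
    refine mul_le_mul_of_nonneg_left ?_ (by norm_num)
    have hmx : 0 < max 1 γ := lt_max_of_lt_left one_pos
    refine Real.sqrt_le_iff.2 ⟨by positivity, ?_⟩
    have hden : 0 < M - 8 * k n := by linarith
    rw [mul_pow, Real.sq_sqrt (by positivity)]
    have e : max 1 γ ^ 2 * ((k n : ℝ) * k n / ((M - 8 * k n) * γ ^ 2) * (Φ + Lg))
        = (k n : ℝ) * k n / (M - 8 * k n) *
          (max 1 γ ^ 2 * (Φ / γ ^ 2) + max 1 γ ^ 2 / γ ^ 2 * Lg) := by field_simp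
    rw [e]
    have h1 : 1 ≤ max 1 γ ^ 2 := one_le_pow₀ (le_max_left _ _)
    have h2 : 1 ≤ max 1 γ ^ 2 / γ ^ 2 := by
      rw [one_le_div (by positivity)]
      gcongr
      exact le_max_right _ _
    have h3 : 0 ≤ Φ / γ ^ 2 := by positivity
    gcongr <;> nlinarith
  unfold RobustBound
  rw [Real.sq_sqrt (Nat.cast_nonneg _)]
  exact ⟨first, second⟩

/-! ### Weights for the nets -/

/-- The pairs of a scale and a list of ranks. -/
abbrev NetSize (n h : ℕ) : Type := ℕ × (Fin n → Fin (h + 1))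

/-- The networks in the net of the given scale (shifted by one) and ranks. -/
def sizedNet (n : ℕ) (k : ℕ → ℕ) (h : ℕ) (T : NetSize n h) : Finset (Weights n k) :=
  weightNet n k h (T.1 + 1) fun l => T.2 l

/-- Networks in the nets, together with scale and ranks. -/
abbrev NetIndex (n : ℕ) (k : ℕ → ℕ) (h : ℕ) : Type :=
  Σ T : NetSize n h, {U : Weights n k // U ∈ sizedNet n k h T}

/-- The weight of a network in the nets; the weights have sum at most one. -/
def netWeight {n : ℕ} {k : ℕ → ℕ} {h : ℕ} (i : NetIndex n k h) : ℝ :=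
  1 / ((i.1.1 + 1 : ℝ) * (i.1.1 + 2)) * (1 / (h + 1 : ℝ) ^ n) *
    (1 / ((sizedNet n k h i.1).card : ℝ))

lemma card_sizedNet_pos {n : ℕ} {k : ℕ → ℕ} {h : ℕ} (i : NetIndex n k h) :
    0 < (sizedNet n k h i.1).card :=
  Finset.card_pos.2 ⟨i.2.1, i.2.2⟩

lemma netWeight_pos {n : ℕ} {k : ℕ → ℕ} {h : ℕ} (i : NetIndex n k h) : 0 < netWeight i := by
  have : (0 : ℝ) < (sizedNet n k h i.1).card := by exact_mod_cast card_sizedNet_pos i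
  unfold netWeight
  positivity

lemma tsum_netWeight_le_one (n : ℕ) (k : ℕ → ℕ) (h : ℕ) :
    ∑' i : NetIndex n k h, ENNReal.ofReal (netWeight i) ≤ 1 := by
  rw [ENNReal.tsum_sigma']
  have h1 : ∀ T : NetSize n h, ∑' U : {U : Weights n k // U ∈ sizedNet n k h T},
      ENNReal.ofReal (netWeight (⟨T, U⟩ : NetIndex n k h)) ≤
        ENNReal.ofReal (1 / ((T.1 + 1 : ℝ) * (T.1 + 2))) *
          ENNReal.ofReal (1 / (h + 1 : ℝ) ^ n) := by
    intro T
    rw [tsum_fintype, ← ENNReal.ofReal_mul (by positivity),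
      ← ENNReal.ofReal_sum_of_nonneg fun U _ => (netWeight_pos _).le]
    refine ENNReal.ofReal_le_ofReal ?_
    simp only [netWeight, Finset.sum_const, Finset.card_univ, Fintype.card_coe, nsmul_eq_mul]
    rw [mul_left_comm]
    refine mul_le_of_le_one_right (by positivity) ?_
    rw [mul_one_div]
    exact div_self_le_one _
  calc _ ≤ ∑' T : NetSize n h, ENNReal.ofReal (1 / ((T.1 + 1 : ℝ) * (T.1 + 2))) *
          ENNReal.ofReal (1 / (h + 1 : ℝ) ^ n) := ENNReal.tsum_le_tsum h1
    _ = (∑' a : ℕ, ENNReal.ofReal (1 / ((a + 1 : ℝ) * (a + 2)))) *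
          ∑' _t : Fin n → Fin (h + 1), ENNReal.ofReal (1 / (h + 1 : ℝ) ^ n) := by
        rw [ENNReal.tsum_prod', ← ENNReal.tsum_mul_right]
        simp only [ENNReal.tsum_mul_left]
    _ ≤ 1 * 1 := by
        refine mul_le_mul' tsum_inv_mul_succ_le_one (le_of_eq ?_)
        rw [tsum_fintype, Finset.sum_const, Finset.card_univ, Fintype.card_fun, Fintype.card_fin,
          Fintype.card_fin, nsmul_eq_mul, ← ENNReal.ofReal_natCast,
          ← ENNReal.ofReal_mul (by positivity)]
        push_cast
        rw [mul_one_div, div_self (by positivity), ENNReal.ofReal_one]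
    _ = 1 := one_mul 1

lemma netWeight_le_one {n : ℕ} {k : ℕ → ℕ} {h : ℕ} (i : NetIndex n k h) : netWeight i ≤ 1 :=
  ENNReal.ofReal_le_one.1 ((ENNReal.le_tsum i).trans (tsum_netWeight_le_one n k h))

lemma log_sixteen_mul_le {n h a : ℕ} (hn : 0 < n) (hh : 2 ≤ h) (ha : 0 < a) :
    Real.log (16 * n * a * h ^ 4 + 1) ≤ 9 * Real.log (n * h) + Real.log a := by
  have hn' : (1 : ℝ) ≤ n := by exact_mod_cast hn
  have ha' : (1 : ℝ) ≤ a := by exact_mod_cast ha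
  have hh' : (2 : ℝ) ≤ h := by exact_mod_cast hh
  have hnh : (2 : ℝ) ≤ n * h := by nlinarith
  rw [← Real.log_rpow (by linarith), ← Real.log_mul (by positivity) (by linarith)]
  refine Real.log_le_log (by positivity) ?_
  rw [show (9 : ℝ) = (9 : ℕ) by norm_num, Real.rpow_natCast]
  have h1 : (1 : ℝ) ≤ n * a * h ^ 4 := by
    have : (1 : ℝ) ≤ h ^ 4 := one_le_pow₀ (by linarith)
    have : (1 : ℝ) ≤ n * a := by nlinarith
    nlinarith
  have h2 : (n : ℝ) * h ^ 4 ≤ (n * h) ^ 4 := by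
    rw [mul_pow]
    gcongr
    exact le_self_pow₀ hn' (by norm_num)
  have h3 : (32 : ℝ) ≤ (n * h) ^ 5 := by
    calc (32 : ℝ) = 2 ^ 5 := by norm_num
      _ ≤ _ := by gcongr
  calc (16 * n * a * h ^ 4 + 1 : ℝ) ≤ 32 * (n * h ^ 4) * a := by nlinarith
    _ ≤ (n * h) ^ 5 * (n * h) ^ 4 * a := by gcongr
    _ = (n * h : ℝ) ^ 9 * a := by ring

/-- The logarithm of the number of networks of given scale and ranks, plus the logarithm of the
weights of scale and ranks. -/
lemma log_netSize_le {n h a : ℕ} (hn : 0 < n) (hh : 2 ≤ h) (ha : 0 < a) {t : Fin n → ℕ}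
    {r : Fin n → ℝ} (hr : ∀ l, 1 ≤ r l) (hth : ∀ l, t l ≤ h)
    (htr : ∀ l, (t l : ℝ) ≤ 16 * (n : ℝ) ^ 2 * (a : ℝ) ^ 2 * r l + 1) :
    Real.log (a * (a + 1)) + n * Real.log (h + 1) +
      2 * h * (∑ l, (t l : ℝ)) * Real.log (16 * n * a * h ^ 4 + 1) ≤
      400 * ((a : ℝ) ^ 2 * n ^ 2 * h * Real.log (n * h) * ∑ l, r l) := by
  have hn' : (1 : ℝ) ≤ n := by exact_mod_cast hn
  have ha' : (1 : ℝ) ≤ a := by exact_mod_cast ha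
  have hh' : (2 : ℝ) ≤ h := by exact_mod_cast hh
  have hnh : (2 : ℝ) ≤ n * h := by nlinarith
  set H := Real.log (n * h) with hH
  have hH2 : 1 / 2 ≤ H := by
    have h1 : Real.log 2 ≤ H := Real.log_le_log (by norm_num) hnh
    have := Real.log_two_gt_d9
    linarith
  have hH0 : 0 < H := by linarith
  have hlh : Real.log h ≤ H := Real.log_le_log (by linarith) (by nlinarith)
  set rs := ∑ l, r l with hrs
  have hrs1 : 1 ≤ rs := by
    have : (n : ℝ) ≤ rs := by
      calc (n : ℝ) = ∑ _l : Fin n, (1 : ℝ) := by simp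
        _ ≤ rs := Finset.sum_le_sum fun l _ => hr l
    linarith
  set Y := (a : ℝ) ^ 2 * n ^ 2 * h * H * rs with hY
  have ha2 : (1 : ℝ) ≤ (a : ℝ) ^ 2 := one_le_pow₀ ha'
  have hn2 : (1 : ℝ) ≤ (n : ℝ) ^ 2 := one_le_pow₀ hn'
  have hlog9 := log_sixteen_mul_le hn hh ha
  have part1 : Real.log (a * (a + 1)) ≤ 4 * Y := by
    have h1 : Real.log (a * (a + 1)) ≤ 2 * a := by
      rw [Real.log_mul (by linarith) (by linarith)]
      have e1 := Real.log_le_sub_one_of_pos (show (0 : ℝ) < a by linarith)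
      have e2 := Real.log_le_sub_one_of_pos (show (0 : ℝ) < (a : ℝ) + 1 by linarith)
      linarith
    have h2 : 4 * ((a : ℝ) * 1 * 1 * (1 / 2) * 1) ≤ 4 * Y := by
      rw [hY]
      gcongr
      · nlinarith
      · linarith
    linarith
  have part2 : n * Real.log (h + 1) ≤ 2 * Y := by
    have h1 : Real.log (h + 1) ≤ 2 * Real.log h := by
      have : Real.log (h + 1) ≤ Real.log ((h : ℝ) ^ 2) :=
        Real.log_le_log (by linarith) (by nlinarith)
      rwa [Real.log_pow, Nat.cast_ofNat] at this
    have h2 : 2 * (1 * (n : ℝ) * 1 * H * 1) ≤ 2 * Y := by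
      rw [hY]
      gcongr
      · nlinarith
      · linarith
    nlinarith
  have part3 : ∀ l, (t l : ℝ) * Real.log (16 * n * a * h ^ 4 + 1) ≤
      187 * ((n : ℝ) ^ 2 * a ^ 2 * H) * r l := by
    intro l
    have hrl := hr l
    have hla : 0 ≤ Real.log a := Real.log_nonneg ha'
    have hX1 : 1 ≤ (n : ℝ) ^ 2 * a ^ 2 * r l := by
      have : 1 ≤ (n : ℝ) ^ 2 * a ^ 2 := by nlinarith
      nlinarith
    have hX : (t l : ℝ) ≤ 17 * ((n : ℝ) ^ 2 * a ^ 2 * r l) := by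
      have := htr l
      linarith
    have hth' : (t l : ℝ) ≤ h := by exact_mod_cast hth l
    have h1 : (t l : ℝ) * Real.log a ≤ 17 * ((n : ℝ) ^ 2 * a ^ 2 * r l) * (2 * H) := by
      -- This keeps `log a` out of the final bound. If `a ≤ h`, it is absorbed by `log (n h)`; if `a
      -- ≥ h`, the cap `t l ≤ h` gives `t l * log a ≤ a ^ 2`.
      rcases le_total (a : ℝ) h with hah | hah
      · have : Real.log a ≤ 2 * H := by
          have := Real.log_le_log (by linarith) hah
          linarith
        gcongr
      · have e1 : Real.log a ≤ a := by
          have := Real.log_le_sub_one_of_pos (show (0 : ℝ) < a by linarith)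
          linarith
        calc (t l : ℝ) * Real.log a ≤ a * a := by
              gcongr
              exact_mod_cast hth'.trans hah
          _ = (1 * (a : ℝ) ^ 2 * 1) * 1 := by ring
          _ ≤ (n : ℝ) ^ 2 * a ^ 2 * r l * (2 * H) := by
              gcongr
              linarith
          _ ≤ 17 * ((n : ℝ) ^ 2 * a ^ 2 * r l) * (2 * H) :=
              mul_le_mul_of_nonneg_right (by linarith) (by linarith)
    calc (t l : ℝ) * Real.log (16 * n * a * h ^ 4 + 1) ≤ t l * (9 * H + Real.log a) := by gcongr
      _ = t l * (9 * H) + t l * Real.log a := by ring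
      _ ≤ 17 * ((n : ℝ) ^ 2 * a ^ 2 * r l) * (9 * H)
          + 17 * ((n : ℝ) ^ 2 * a ^ 2 * r l) * (2 * H) := by gcongr
      _ = _ := by ring
  have part3' : 2 * h * (∑ l, (t l : ℝ)) * Real.log (16 * n * a * h ^ 4 + 1) ≤ 374 * Y := by
    calc 2 * h * (∑ l, (t l : ℝ)) * Real.log (16 * n * a * h ^ 4 + 1)
        = 2 * h * ∑ l, (t l : ℝ) * Real.log (16 * n * a * h ^ 4 + 1) := by
          rw [mul_assoc, Finset.sum_mul]
      _ ≤ 2 * h * ∑ l, 187 * ((n : ℝ) ^ 2 * a ^ 2 * H) * r l := by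
          refine mul_le_mul_of_nonneg_left (Finset.sum_le_sum fun l _ => part3 l) ?_
          positivity
      _ = 374 * Y := by rw [← Finset.mul_sum, hY]; ring
  have hY0 : 0 ≤ Y := by positivity
  linarith

lemma neg_log_netWeight_le {n : ℕ} {k : ℕ → ℕ} {h : ℕ} (hk : ∀ l ≤ n, k l ≤ h) (hn : 0 < n)
    (hh : 2 ≤ h) (i : NetIndex n k h) {r : Fin n → ℝ} (hr : ∀ l, 1 ≤ r l)
    (htr : ∀ l, ((i.1.2 l : ℕ) : ℝ) ≤
      16 * (n : ℝ) ^ 2 * ((i.1.1 + 1 : ℕ) : ℝ) ^ 2 * r l + 1) :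
    -Real.log (netWeight i) ≤
      400 * (((i.1.1 + 1 : ℕ) : ℝ) ^ 2 * n ^ 2 * h * Real.log (n * h) * ∑ l, r l) := by
  have hcard : (0 : ℝ) < (sizedNet n k h i.1).card := by exact_mod_cast card_sizedNet_pos i
  refine le_trans ?_ (log_netSize_le (a := i.1.1 + 1) (t := fun l => i.1.2 l) hn hh
    (Nat.succ_pos _) hr (fun l => Nat.lt_succ_iff.1 (i.1.2 l).2) htr)
  have e : netWeight i = (((i.1.1 + 1 : ℕ) * ((i.1.1 + 1 : ℕ) + 1) : ℝ) * (h + 1 : ℝ) ^ n *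
      ((sizedNet n k h i.1).card : ℝ))⁻¹ := by
    unfold netWeight
    push_cast
    rw [mul_inv, mul_inv, one_div, one_div, one_div]
    ring_nf
  rw [e, Real.log_inv, neg_neg, Real.log_mul (by positivity) hcard.ne',
    Real.log_mul (by positivity) (by positivity), Real.log_pow]
  refine add_le_add le_rfl ?_
  have h1 : ((sizedNet n k h i.1).card : ℝ) ≤
      (16 * n * (i.1.1 + 1 : ℕ) * h ^ 4 + 1 : ℝ) ^ (2 * h * ∑ l, (i.1.2 l : ℕ)) := by
    exact_mod_cast card_weightNet_le hk (i.1.1 + 1) fun l => i.1.2 l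
  have h2 := Real.log_le_log hcard h1
  rw [Real.log_pow] at h2
  push_cast at h2 ⊢
  exact h2

/-! ### The two parts of the theorem -/

/-- The failure of a class-wise deviation bound for a family of events with weights `w`. -/
def DeviationFails {Ω ι : Type*} [MeasurableSpace Ω] {m c : ℕ} (D : Measure Ω) (w : ι → ℝ)
    (L : Fin c → Set Ω) (E : ι → Fin c → Set Ω) (δ : ℝ) (S : Fin m → Ω) : Prop :=
  ∃ i j, ∃ s : ℕ, 0 < s ∧ sampleCount S (L j) = s ∧
    sampleCount S (L j ∩ E i j) + √(s * Real.log (c * (s * (s + 1)) / (δ * w i)) / 2)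
      < s * (ProbabilityTheory.cond D (L j)).real (E i j)

/-- If the events `E i j` contain the robust errors and, on the sample, imply small margins, then
the deviation bound for `E i` gives the bound on the confusion matrices. -/
lemma robustBound_of_not_deviationFails {n m h : ℕ} {k : ℕ → ℕ} (hn : 0 < n) (hk : 2 ≤ k n)
    {B ε δ γ : ℝ} (hδ : 0 < δ) (hδ1 : δ < 1) (hγ : 0 < γ)
    {D : Measure (EuclideanSpace ℝ (Fin (k 0)) × Fin (k n))} [IsProbabilityMeasure D]
    {S : Fin m → EuclideanSpace ℝ (Fin (k 0)) × Fin (k n)} (hS : 8 * k n < minClassCount S)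
    {W : Weights n k}
    {A : EuclideanSpace ℝ (Fin (k 0)) × Fin (k n) → EuclideanSpace ℝ (Fin (k 0))}
    (hA : Measurable A) {ι : Type*} {w : ι → ℝ}
    {E : ι → Fin (k n) → Set (EuclideanSpace ℝ (Fin (k 0)) × Fin (k n))}
    (hfail : ¬ DeviationFails D w (fun j => {p | p.2 = j}) E δ S) (i : ι) (hw : 0 < w i)
    (hΛ : -Real.log (w i) ≤ 40000 * (complexity h B ε W / γ ^ 2))
    (htrue : ∀ j, ∀ᵐ p ∂D, MarginLE (net W (A p)) j 0 → p.2 = j → p ∈ E i j)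
    (hemp : ∀ j q, (S q).2 = j → S q ∈ E i j → MarginLE (net W (A (S q))) j γ) :
    RobustBound 200 (√(k n)) h B ε δ γ D S W A := by
  refine robustBound_of_deviation hn hk hδ hδ1 hγ D S hS W hA hΛ fun j => ?_
  have hmin : minClassCount S ≤ classCount S j := ciInf_le' _ j
  have hs : 0 < classCount S j := by omega
  have hs' : (0 : ℝ) < classCount S j := by exact_mod_cast hs
  have hc' : (0 : ℝ) < k n := by exact_mod_cast (by omega : 0 < k n)
  have hdev := not_exists.1 (not_exists.1 (not_exists.1 hfail i) j) (classCount S j)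
  have hdev := not_lt.1 fun hlt => hdev ⟨hs, sampleCount_label S j, hlt⟩
  -- The price of the union bound separates as `-log (w i)`, which plays the role of `Λ`.
  have e : Real.log (k n * (classCount S j * (classCount S j + 1)) / (δ * w i)) =
      -Real.log (w i) + Real.log (k n * (classCount S j * (classCount S j + 1)) / δ) := by
    rw [← div_div, Real.log_div (by positivity) hw.ne']
    ring
  rw [e] at hdev
  refine le_trans ?_ (hdev.trans (add_le_add ?_ le_rfl))
  · refine mul_le_mul_of_nonneg_left ?_ hs'.le
    refine ENNReal.toReal_mono (measure_ne_top _ _) ?_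
    have hlab := measurableSet_label (X := EuclideanSpace ℝ (Fin (k 0))) j
    rw [cond_apply hlab, cond_apply hlab]
    refine mul_le_mul_right ?_ _
    refine measure_mono_ae ?_
    filter_upwards [htrue j] with p hp hpm
    exact ⟨hpm.1, hp hpm.2 hpm.1⟩
  · refine sampleCount_mono fun q hq => ⟨hq.1, ?_⟩
    exact hemp j q hq.1 hq.2

/-- A one-element family of weight one suffices, so the complexity term is not needed. Of the attack
only measurability enters, hence the loss is arbitrary. -/
lemma measure_fixed_net_le {n h m : ℕ} {k : ℕ → ℕ} (hn : 0 < n) (hk : 2 ≤ k n)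
    {B ε δ γ : ℝ} (hδ : 0 < δ) (hδ1 : δ < 1) (hγ : 0 < γ)
    (D : Measure (EuclideanSpace ℝ (Fin (k 0)) × Fin (k n))) [IsProbabilityMeasure D]
    (W : Weights n k)
    {A : EuclideanSpace ℝ (Fin (k 0)) × Fin (k n) → EuclideanSpace ℝ (Fin (k 0))}
    (hA : Measurable A) :
    (Measure.pi fun _ : Fin m => D)
      {S | ¬ (8 * k n < minClassCount S → RobustBound 200 (√(k n)) h B ε δ γ D S W A)}
        ≤ ENNReal.ofReal δ := by
  let E : Unit → Fin (k n) → Set (EuclideanSpace ℝ (Fin (k 0)) × Fin (k n)) :=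
    fun _ j => {p | MarginLE (net W (A p)) j 0}
  have hE : ∀ i j, MeasurableSet (E i j) := fun _ j =>
    measurableSet_marginLE ((continuous_net W).measurable.comp hA) j 0
  refine (measure_mono fun S hS => ?_).trans
    (measure_exists_deviation_le D (w := fun _ : Unit => 1) (fun _ => one_pos) (fun _ => le_rfl)
      (by simp) (by omega) (fun j => measurableSet_label j) hE hδ hδ1 m)
  by_contra hfail
  refine hS fun hmin => ?_
  refine robustBound_of_not_deviationFails hn hk hδ hδ1 hγ hmin hA hfail () one_pos ?_
    (fun j => ae_of_all _ fun p hp _ => hp) (fun j q _ hq => MarginLE.mono hq hγ.le)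
  have := complexity_nonneg h B ε W
  rw [Real.log_one, neg_zero]
  positivity

/-- The adversarial event for a score function `g`: some input near `x` has a small margin. -/
def nearSmallMargin {d c : ℕ} (ε θ : ℝ) (g : EuclideanSpace ℝ (Fin d) → Fin c → ℝ) (j : Fin c) :
    Set (EuclideanSpace ℝ (Fin d) × Fin c) :=
  {p | p.1 ∈ Metric.cthickening ε {x | MarginLE (g x) j θ}}

lemma measurableSet_nearSmallMargin {d c : ℕ} (ε θ : ℝ)
    (g : EuclideanSpace ℝ (Fin d) → Fin c → ℝ) (j : Fin c) :
    MeasurableSet (nearSmallMargin ε θ g j) :=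
  measurable_fst Metric.isClosed_cthickening.measurableSet

/-- The set of small margins is closed and Euclidean space is proper, so the closed thickening is a
union of closed balls. Defining the event by a thickening makes its measurability immediate. -/
lemma mem_nearSmallMargin {d c : ℕ} {ε θ : ℝ} (hε : 0 ≤ ε)
    {g : EuclideanSpace ℝ (Fin d) → Fin c → ℝ} (hg : Continuous g) {j : Fin c}
    {p : EuclideanSpace ℝ (Fin d) × Fin c} :
    p ∈ nearSmallMargin ε θ g j ↔ ∃ x', ‖x' - p.1‖ ≤ ε ∧ MarginLE (g x') j θ := by
  rw [nearSmallMargin, Set.mem_ofPred_eq,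
    (isClosed_marginLE hg j θ).cthickening_eq_biUnion_closedBall hε]
  simp only [Set.mem_iUnion, Metric.mem_closedBall, Set.mem_ofPred_eq, exists_prop, dist_comm p.1,
    dist_eq_norm, and_comm]

/-- For an attack with a margin loss, a small margin near `x` gives a small margin at the
adversarial example. -/
lemma IsAttack.marginLE {d c : ℕ} {B ε : ℝ} {ℓ : (Fin c → ℝ) → Fin c → ℝ}
    {f : EuclideanSpace ℝ (Fin d) → Fin c → ℝ}
    {A : EuclideanSpace ℝ (Fin d) × Fin c → EuclideanSpace ℝ (Fin d)} (hA : IsAttack B ε ℓ f A)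
    (hℓ : IsMarginLoss ℓ) {x x' : EuclideanSpace ℝ (Fin d)} {j i₀ : Fin c} (hi₀ : i₀ ≠ j)
    (hx : ‖x‖ ≤ B) (hx' : ‖x' - x‖ ≤ ε) {θ : ℝ} (h : MarginLE (f x') j θ) :
    MarginLE (f (A (x, j))) j θ := by
  refine marginLE_of_margin_le hi₀ (not_lt.1 fun hlt => ?_)
  exact absurd (hA.isMax x j hx x' hx') (not_le.2 (hℓ _ _ j (h.margin_le.trans_lt hlt)))

/-- Scores of a network in the nets, on the scale it stands for. -/
def netScore {n : ℕ} {k : ℕ → ℕ} {h : ℕ} (R γ : ℝ) (i : NetIndex n k h)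
    (x : EuclideanSpace ℝ (Fin (k 0))) : Fin (k n) → ℝ :=
  (((i.1.1 + 1 : ℕ) : ℝ) * γ / (8 * R)) • net i.2.1 x

/-- A network all of whose margins are small satisfies the bound for trivial reasons. -/
lemma robustBound_of_marginLE {n m h : ℕ} {k : ℕ → ℕ} (hn : 0 < n) (hk : 2 ≤ k n)
    {B ε δ γ : ℝ} (hδ : 0 < δ) (hδ1 : δ < 1) (hγ : 0 < γ)
    {D : Measure (EuclideanSpace ℝ (Fin (k 0)) × Fin (k n))} [IsProbabilityMeasure D]
    {S : Fin m → EuclideanSpace ℝ (Fin (k 0)) × Fin (k n)} (hS : 8 * k n < minClassCount S)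
    {W : Weights n k}
    {A : EuclideanSpace ℝ (Fin (k 0)) × Fin (k n) → EuclideanSpace ℝ (Fin (k 0))}
    (hA : Measurable A) (hW : ∀ j q, MarginLE (net W (A (S q))) j γ) :
    RobustBound 200 (√(k n)) h B ε δ γ D S W A := by
  refine robustBound_of_deviation hn hk hδ hδ1 hγ D S hS W hA (Λ := 0)
    (by have := complexity_nonneg h B ε W; positivity) fun j => ?_
  refine le_trans ?_ (le_add_of_nonneg_right (Real.sqrt_nonneg _))
  have h1 : (classCount S j : ℝ) ≤
      sampleCount (advSample A S) ({p | p.2 = j} ∩ {p | MarginLE (net W p.1) j γ}) := by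
    rw [← sampleCount_label]
    exact sampleCount_mono fun q hq => ⟨hq, hW j q⟩
  refine le_trans (mul_le_of_le_one_right (Nat.cast_nonneg _) ?_) h1
  refine ENNReal.toReal_le_of_le_ofReal zero_le_one ?_
  rw [ENNReal.ofReal_one]
  by_cases h0 : D {p | p.2 = j} = 0
  · rw [cond_eq_zero.2 (Or.inr h0)]
    simp
  · have := cond_isProbabilityMeasure h0
    exact prob_le_one

lemma exists_netIndex {n : ℕ} {k : ℕ → ℕ} {h : ℕ} (hk : ∀ l ≤ n, k l ≤ h) (hn : 0 < n)
    (hh : 2 ≤ h) {B ε γ : ℝ} (hR : 0 < B + ε) (hγ : 0 < γ) (W : Weights n k)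
    (hW : ∀ l, specNorm (W l) ≠ 0) (hlarge : γ / 2 < (∏ l, specNorm (W l)) * (B + ε)) :
    ∃ i : NetIndex n k h,
      -Real.log (netWeight i) ≤ 40000 * (complexity h B ε W / γ ^ 2) ∧
      ∀ x, ‖x‖ ≤ B + ε → ∀ y, |netScore (B + ε) γ i x y - net W x y| ≤ γ / 4 := by
  -- `hlarge` says `K > 1 / 2`, so the scale `⌈8 K⌉₊ ≤ 8 K + 1` is at most `10 K`. Its square turns
  -- the constant `400` into `40000`, and `K ^ 2` supplies the factor `(B + ε)² ∏ ‖W_l‖₂² / γ²` of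
  -- the complexity.
  set α := ∏ l, specNorm (W l) with hα
  set K := (B + ε) * α / γ with hK
  have hK2 : 1 / 2 < K := by
    rw [hK, lt_div_iff₀ hγ]; linarith
  obtain ⟨a, ha⟩ : ∃ a, ⌈8 * K⌉₊ = a + 1 :=
    ⟨⌈8 * K⌉₊ - 1, by have := Nat.ceil_pos.2 (show 0 < 8 * K by linarith); omega⟩
  have haK : ((a + 1 : ℕ) : ℝ) ≤ 10 * K := by
    have := Nat.ceil_lt_add_one (a := 8 * K) (by linarith)
    rw [ha] at this
    linarith
  obtain ⟨t, hth, htr, U, hU, hUW⟩ := exists_net_approx (a := a + 1) hk hn (by omega) W hW hR hγ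
    (by rw [← ha])
  let i : NetIndex n k h := ⟨(a, fun l => ⟨t l, Nat.lt_succ_iff.2 (hth l)⟩), ⟨U, hU⟩⟩
  refine ⟨i, ?_, fun x hx y => by simpa [netScore, i] using hUW x hx y⟩
  have hr : ∀ l, 1 ≤ frobSq (W l) / specNorm (W l) ^ 2 := fun l => by
    have : 0 < specNorm (W l) ^ 2 := by have := hW l; positivity
    rw [one_le_div this]
    exact specNorm_sq_le_frobSq _
  refine (neg_log_netWeight_le hk hn hh i hr htr).trans ?_
  have hlog : 0 ≤ Real.log (n * h) := by exact_mod_cast Real.log_natCast_nonneg (n * h)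
  have hsum : 0 ≤ ∑ l, frobSq (W l) / specNorm (W l) ^ 2 :=
    Finset.sum_nonneg fun l _ => zero_le_one.trans (hr l)
  calc 400 * (((a + 1 : ℕ) : ℝ) ^ 2 * n ^ 2 * h * Real.log (n * h) *
        ∑ l, frobSq (W l) / specNorm (W l) ^ 2)
      ≤ 400 * ((10 * K) ^ 2 * n ^ 2 * h * Real.log (n * h) *
        ∑ l, frobSq (W l) / specNorm (W l) ^ 2) := by gcongr
    _ = 40000 * (complexity h B ε W / γ ^ 2) := by
        rw [complexity, Finset.prod_pow, ← hα, hK]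
        field_simp
        ring

lemma measure_all_nets_le {n h m : ℕ} {k : ℕ → ℕ} (hn : 0 < n) (hk : 2 ≤ k n)
    (hkh : ∀ l ≤ n, k l ≤ h) {B ε δ γ : ℝ} (hB : 0 < B) (hε : 0 < ε) (hδ : 0 < δ) (hδ1 : δ < 1)
    (hγ : 0 < γ) (D : Measure (EuclideanSpace ℝ (Fin (k 0)) × Fin (k n)))
    [IsProbabilityMeasure D] (hD : ∀ᵐ p ∂D, ‖p.1‖ ≤ B) :
    (Measure.pi fun _ : Fin m => D)
      {S | ¬ (8 * k n < minClassCount S →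
        ∀ (ℓ : (Fin (k n) → ℝ) → Fin (k n) → ℝ) (W : Weights n k)
          (A : EuclideanSpace ℝ (Fin (k 0)) × Fin (k n) → EuclideanSpace ℝ (Fin (k 0))),
          IsMarginLoss ℓ → IsAttack B ε ℓ (net W) A →
          RobustBound 200 (√(k n)) h B ε δ γ D S W A)} ≤ ENNReal.ofReal δ := by
  have hR : 0 < B + ε := by linarith
  have hh : 2 ≤ h := hk.trans (hkh n le_rfl)
  have hother : ∀ j : Fin (k n), ∃ i₀, i₀ ≠ j := fun j =>
    have : Nontrivial (Fin (k n)) := Fin.nontrivial_iff_two_le.2 hk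
    exists_ne j
  let E : NetIndex n k h → Fin (k n) → Set (EuclideanSpace ℝ (Fin (k 0)) × Fin (k n)) :=
    fun i j => nearSmallMargin ε (γ / 2) (netScore (B + ε) γ i) j
  have hcont : ∀ i : NetIndex n k h, Continuous (netScore (B + ε) γ i) := fun i =>
    (continuous_net i.2.1).const_smul (((i.1.1 + 1 : ℕ) : ℝ) * γ / (8 * (B + ε)))
  have hSB : ∀ᵐ S ∂(Measure.pi fun _ : Fin m => D), ∀ q, ‖(S q).1‖ ≤ B := by
    rw [ae_all_iff]
    exact fun q => (measurePreserving_eval (fun _ : Fin m => D) q).quasiMeasurePreserving.ae hD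
  refine (measure_mono_ae ?_).trans
    (measure_exists_deviation_le D (w := netWeight (n := n) (k := k) (h := h)) netWeight_pos
      netWeight_le_one (tsum_netWeight_le_one n k h) (by omega) (fun j => measurableSet_label j)
      (fun i j => measurableSet_nearSmallMargin ε (γ / 2) (netScore (B + ε) γ i) j) hδ hδ1 m)
  filter_upwards [hSB] with S hSB hS
  by_contra hfail
  refine hS fun hmin ℓ W A hℓ hA => ?_
  have hAR : ∀ p, ‖p.1‖ ≤ B → ‖A p‖ ≤ B + ε := fun p hp =>
    calc ‖A p‖ = ‖p.1 + (A p - p.1)‖ := by rw [add_sub_cancel]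
      _ ≤ ‖p.1‖ + ‖A p - p.1‖ := norm_add_le _ _
      _ ≤ B + ε := add_le_add hp (hA.mem_ball p.1 p.2 hp)
  by_cases hW : ∀ l, specNorm (W l) ≠ 0
  -- If this fails, all scores at the adversarial examples are at most `γ / 2` in absolute value, so
  -- every margin there is at most `γ` and the empirical error of each class is already one.
  · by_cases hlarge : γ / 2 < (∏ l, specNorm (W l)) * (B + ε)
    · obtain ⟨i, hi, happ⟩ := exists_netIndex hkh hn hh hR hγ W hW hlarge
      refine robustBound_of_not_deviationFails hn hk hδ hδ1 hγ hmin hA.measurable hfail i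
        (netWeight_pos i) hi ?_ ?_
      -- Score accuracy `γ / 4` shifts margins by at most `γ / 2`: margin `0` of the true network
      -- becomes `γ / 2` for the approximation, and going back, `γ / 2` becomes `γ`.
      · intro j
        filter_upwards [hD] with p hp hm _
        refine (mem_nearSmallMargin hε.le (hcont i)).2 ⟨A p, hA.mem_ball p.1 p.2 hp, ?_⟩
        exact (hm.of_abs_sub_le (happ _ (hAR p hp))).mono (by linarith)
      · intro j q hq hqE
        obtain ⟨x', hx', hm⟩ := (mem_nearSmallMargin hε.le (hcont i)).1 hqE
        obtain ⟨i₀, hi₀⟩ := hother j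
        have hx'R : ‖x'‖ ≤ B + ε :=
          calc ‖x'‖ = ‖(S q).1 + (x' - (S q).1)‖ := by rw [add_sub_cancel]
            _ ≤ ‖(S q).1‖ + ‖x' - (S q).1‖ := norm_add_le _ _
            _ ≤ B + ε := add_le_add (hSB q) hx'
        have hm' : MarginLE (net W x') j γ :=
          (hm.of_abs_sub_le fun y => by rw [abs_sub_comm]; exact happ x' hx'R y).mono (by linarith)
        have := hA.marginLE hℓ hi₀ (hSB q) hx' hm'
        rw [← hq] at this ⊢
        exact this
    · refine robustBound_of_marginLE hn hk hδ hδ1 hγ hmin hA.measurable fun j q => ?_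
      obtain ⟨i₀, hi₀⟩ := hother j
      have hb : ∀ y, |net W (A (S q)) y| ≤ γ / 2 := fun y =>
        (abs_apply_le_l2 _ y).trans ((l2_net_le W hW _).trans
          ((mul_le_mul_of_nonneg_left (hAR _ (hSB q))
            (Finset.prod_nonneg fun l _ => specNorm_nonneg _)).trans (not_lt.1 hlarge)))
      exact ⟨i₀, hi₀, by linarith [(abs_le.1 (hb j)).2, (abs_le.1 (hb i₀)).1]⟩
  · push Not at hW
    obtain ⟨l₀, hl₀⟩ := hW
    refine robustBound_of_marginLE hn hk hδ hδ1 hγ hmin hA.measurable fun j q => ?_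
    obtain ⟨i₀, hi₀⟩ := hother j
    rw [net_eq_zero (specNorm_eq_zero.1 hl₀)]
    exact ⟨i₀, hi₀, by simpa using hγ.le⟩

end RobustConfusion

end

theorem mainTheorem1 :
    ∃ (C : ℝ) (ν : ℕ → ℝ), 0 < C ∧ (∀ c : ℕ, 0 < c → 0 < ν c ∧ ν c ≤ √c) ∧
      ∀ (n h m : ℕ) (k : ℕ → ℕ) (B ε δ γ : ℝ)
        (D : Measure (EuclideanSpace ℝ (Fin (k 0)) × Fin (k n))) [IsProbabilityMeasure D],
        0 < n → (∀ l ≤ n, k l ≤ h) → 0 < B → 0 < ε → 0 < δ → 0 < γ →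
        (∀ᵐ p ∂D, ‖p.1‖ ≤ B) →
        -- any loss, for each network
        (∀ (ℓ : (Fin (k n) → ℝ) → Fin (k n) → ℝ) (W : RobustConfusion.Weights n k)
            (A : EuclideanSpace ℝ (Fin (k 0)) × Fin (k n) → EuclideanSpace ℝ (Fin (k 0))),
            RobustConfusion.IsAttack B ε ℓ (RobustConfusion.net W) A →
            (Measure.pi fun _ : Fin m => D)
              {S | ¬ (8 * k n < RobustConfusion.minClassCount S →
                RobustConfusion.RobustBound C (ν (k n)) h B ε δ γ D S W A)}
              ≤ ENNReal.ofReal δ) ∧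
        -- losses governed by the margin, for all networks at once
        (Measure.pi fun _ : Fin m => D)
          {S | ¬ (8 * k n < RobustConfusion.minClassCount S →
            ∀ (ℓ : (Fin (k n) → ℝ) → Fin (k n) → ℝ) (W : RobustConfusion.Weights n k)
              (A : EuclideanSpace ℝ (Fin (k 0)) × Fin (k n) → EuclideanSpace ℝ (Fin (k 0))),
              RobustConfusion.IsMarginLoss ℓ →
              RobustConfusion.IsAttack B ε ℓ (RobustConfusion.net W) A →
              RobustConfusion.RobustBound C (ν (k n)) h B ε δ γ D S W A)}
          ≤ ENNReal.ofReal δ := by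
  -- `200 = √40000` matches the constant of the log-weight bound. The cases `δ ≥ 1` and at most one
  -- class are trivial and are split off below.
  refine ⟨200, fun c => √c, by norm_num, fun c hc => ⟨by positivity, le_rfl⟩, ?_⟩
  intro n h m k B ε δ γ D _ hn hkh hB hε hδ hγ hD
  by_cases hk : 2 ≤ k n
  · by_cases hδ1 : δ < 1
    · exact ⟨fun ℓ W A hA => RobustConfusion.measure_fixed_net_le hn hk hδ hδ1 hγ D W hA.measurable,
        RobustConfusion.measure_all_nets_le hn hk hkh hB hε hδ hδ1 hγ D hD⟩
    · have h1 : 1 ≤ ENNReal.ofReal δ := ENNReal.one_le_ofReal.2 (not_lt.1 hδ1)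
      exact ⟨fun _ _ _ _ => prob_le_one.trans h1, prob_le_one.trans h1⟩
  · have hbound := fun (S : Fin m → EuclideanSpace ℝ (Fin (k 0)) × Fin (k n)) W A =>
      RobustConfusion.robustBound_of_subsingleton (m := m) (C := 200) (ν := √(k n)) (B := B)
        (ε := ε) (δ := δ) (γ := γ) (by omega) (by norm_num) (Real.sqrt_nonneg _) h D S W A
    simp [hbound]
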